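/- For every constant $\varepsilon>0$ there is a polynomial-time $(1-\varepsilon)$-approximation algorithm for the offline $K$-MAX problem; that is, the offline $K$-MAX problem has a PTAS. In detail: an instance consists of natural numbers $m,K$ and, for each arm $i\in[m]$, a finite list of nonnegative rational values $v_{i,1},\dots,v_{i,s_i}$ with rational probabilities $p_{i,1},\dots,p_{i,s_i}\ge 0$, $\sum_j p_{i,j}=1$, all numbers being written in binary (rationals as numerator and denominator in lowest terms). Let $X_1,\dots,X_m$ be independent random variables such that $X_i$ has distribution $\sum_j p_{i,j}\,\delta_{v_{i,j}}$, and for $S\subseteq[m]$ let $r(S)=\mathbb E[\max_{i\in S}X_i]$, with $\max_{i\in\emptyset}X_i=0$. For every real $\varepsilon>0$ there are an algorithm (a program for a random access machine with logarithmic cost) and a polynomial $q$ such that on every instance, of bit length $n$, the algorithm halts within time $q(n)$ and outputs the characteristic vector of a set $S\subseteq[m]$ with $|S|\le K$, and with $|S|=K$ if $K\le m$, such that $$ r(S)\;\ge\;(1-\varepsilon)\max_{T\subseteq[m],\ |T|\le K} r(T). $$ -/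

import Mathlib

open scoped NNReal ENNReal NNRat

/-! A random access machine with logarithmic cost, programmed in a structured language. -/

namespace RAM

/-- Expressions over the memory. The memory consists of arrays `a = 0, 1, 2, …` (of which a program
mentions finitely many), each with cells `0, 1, 2, …` holding natural numbers of any size.
A program variable is a cell with a constant index. -/
inductive Expr : Type
  | const (n : ℕ) : Expr
  | get (a : ℕ) (idx : Expr) : Expr
  | add (e₁ e₂ : Expr) : Expr
  | sub (e₁ e₂ : Expr) : Expr
  | mul (e₁ e₂ : Expr) : Expr
  | div (e₁ e₂ : Expr) : Expr

/-- Commands; `set a idx e` is the assignment `a[idx] := e`, and a condition holds when its value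
is nonzero. -/
inductive Cmd : Type
  | skip : Cmd
  | set (a : ℕ) (idx e : Expr) : Cmd
  | seq (c₁ c₂ : Cmd) : Cmd
  | ite (e : Expr) (c₁ c₂ : Cmd) : Cmd
  | while (e : Expr) (c : Cmd) : Cmd

/-- A memory state: array number, then cell number, to content. -/
abbrev State : Type := ℕ → ℕ → ℕ

/-- Value of an expression (truncated subtraction, integer division, `x / 0 = 0`). -/
def Expr.eval (σ : State) : Expr → ℕ
  | .const n => n
  | .get a idx => σ a (idx.eval σ)
  | .add e₁ e₂ => e₁.eval σ + e₂.eval σ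
  | .sub e₁ e₂ => e₁.eval σ - e₂.eval σ
  | .mul e₁ e₂ => e₁.eval σ * e₂.eval σ
  | .div e₁ e₂ => e₁.eval σ / e₂.eval σ

/-- Logarithmic cost of evaluating an expression: every operation costs one plus the bit lengths of
the numbers it handles (for a memory access: of the index and of the content). -/
def Expr.cost (σ : State) : Expr → ℕ
  | .const n => 1 + n.size
  | .get a idx => idx.cost σ + 1 + (idx.eval σ).size + (σ a (idx.eval σ)).size
  | .add e₁ e₂ => e₁.cost σ + e₂.cost σ + 1 + (e₁.eval σ).size + (e₂.eval σ).size
  | .sub e₁ e₂ => e₁.cost σ + e₂.cost σ + 1 + (e₁.eval σ).size + (e₂.eval σ).size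
  | .mul e₁ e₂ => e₁.cost σ + e₂.cost σ + 1 + (e₁.eval σ).size + (e₂.eval σ).size
  | .div e₁ e₂ => e₁.cost σ + e₂.cost σ + 1 + (e₁.eval σ).size + (e₂.eval σ).size

/-- The state after the assignment `a[i] := v`. -/
def State.write (σ : State) (a i v : ℕ) : State :=
  fun a' i' => if a' = a ∧ i' = i then v else σ a' i'

/-- `Exec c σ t σ'`: the command `c`, started in state `σ`, halts in state `σ'` after running for
time `t` (logarithmic cost). -/
inductive Exec : Cmd → State → ℕ → State → Prop
  | skip (σ : State) : Exec .skip σ 1 σ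
  | set (a : ℕ) (idx e : Expr) (σ : State) :
      Exec (.set a idx e) σ
        (idx.cost σ + e.cost σ + 1 + (idx.eval σ).size + (e.eval σ).size)
        (σ.write a (idx.eval σ) (e.eval σ))
  | seq {c₁ c₂ : Cmd} {σ₀ σ₁ σ₂ : State} {t₁ t₂ : ℕ} :
      Exec c₁ σ₀ t₁ σ₁ → Exec c₂ σ₁ t₂ σ₂ → Exec (.seq c₁ c₂) σ₀ (t₁ + t₂) σ₂
  | ite_true {e : Expr} {c₁ c₂ : Cmd} {σ σ' : State} {t : ℕ} :
      e.eval σ ≠ 0 → Exec c₁ σ t σ' →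
        Exec (.ite e c₁ c₂) σ (e.cost σ + 1 + (e.eval σ).size + t) σ'
  | ite_false {e : Expr} {c₁ c₂ : Cmd} {σ σ' : State} {t : ℕ} :
      e.eval σ = 0 → Exec c₂ σ t σ' →
        Exec (.ite e c₁ c₂) σ (e.cost σ + 1 + (e.eval σ).size + t) σ'
  | while_true {e : Expr} {c : Cmd} {σ₀ σ₁ σ₂ : State} {t₁ t₂ : ℕ} :
      e.eval σ₀ ≠ 0 → Exec c σ₀ t₁ σ₁ → Exec (.while e c) σ₁ t₂ σ₂ →
        Exec (.while e c) σ₀ (e.cost σ₀ + 1 + (e.eval σ₀).size + t₁ + t₂) σ₂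
  | while_false {e : Expr} {c : Cmd} {σ : State} :
      e.eval σ = 0 → Exec (.while e c) σ (e.cost σ + 1 + (e.eval σ).size) σ

/-- The initial state: the input occupies the first cells of array `0`, all else is zero. -/
def initState (input : List ℕ) : State :=
  fun a i => if a = 0 then input.getD i 0 else 0

/-- The length of an input in bits, with one extra unit per number as separator. -/
def bitLength (input : List ℕ) : ℕ := (input.map fun n => n.size + 1).sum

end RAM

/-- An instance of the offline `K`-MAX problem: a bound `K` and `m` arms, where the outcome of arm
`i` takes the value `v i j ≥ 0` with probability `p i j`. -/
structure KMaxInstance where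
  m : ℕ
  K : ℕ
  s : Fin m → ℕ
  v : (i : Fin m) → Fin (s i) → ℚ≥0
  p : (i : Fin m) → Fin (s i) → ℚ≥0
  sum_p : ∀ i, ∑ j, p i j = 1

namespace KMaxInstance

/-- The input given to an algorithm: `m`, `K` and, arm by arm, the number of listed values followed
by numerator and denominator (in lowest terms) of each value and of its probability. -/
def encode (I : KMaxInstance) : List ℕ :=
  I.m :: I.K :: (List.finRange I.m).flatMap fun i =>
    I.s i :: (List.finRange (I.s i)).flatMap fun j =>
      [(I.v i j).num, (I.v i j).den, (I.p i j).num, (I.p i j).den]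

/-- The distribution of the outcome of arm `i`. -/
noncomputable def law (I : KMaxInstance) (i : Fin I.m) : MeasureTheory.Measure ℝ≥0 :=
  ∑ j, ((I.p i j : ℝ≥0) : ℝ≥0∞) • MeasureTheory.Measure.dirac (I.v i j : ℝ≥0)

/-- The expected reward `E[max_{i ∈ S} X_i]`, where the `X_i` are independent with distributions
`law i`; the maximum over the empty set is `0`. -/
noncomputable def reward (I : KMaxInstance) (S : Finset (Fin I.m)) : ℝ :=
  ∫ x : Fin I.m → ℝ≥0, ((S.sup x : ℝ≥0) : ℝ) ∂MeasureTheory.Measure.pi I.law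

end KMaxInstance

/-! # A polynomial-time approximation scheme for offline `K`-MAX

Fix a large integer `e` and a unit of length `u`. For a set `S` of arms, `E[max]` is approximated by a
*surrogate*: below the threshold `B = e² u` the maximum is cut into `e²` layers of height `u`, and the
layer with top `t` contributes `u * P(max ≥ t) = u * (1 - ∏ P(X_i < t))`; above `B` the excess of the
maximum is replaced by the sum of the individual mean excesses `E[(X_i - B)⁺]`. The surrogate loses at
most one layer (`ExpMax.integral_sup_le`). Conversely it is accurate if `E[max]` is small compared with
`B`, because then, by Markov's inequality, rarely more than one variable exceeds `B`
(`ExpMax.surrogate_le`). So if `e u` is within a constant factor of the optimum, maximizing the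
surrogate is good enough.

The surrogate is maximized by dynamic programming. A state consists of the number of arms chosen so
far and, for each of the `e²` layers, the product of the probabilities, rounded to a multiple of
`1 / (e² m + 1)` after each factor; a factor is at most `1` and does not enlarge earlier errors, so the
roundings add up to at most one layer (`ExpMax.estimate_bounds`). The number of states is polynomial
because `e` is constant. The mean excesses are additive, and the table records for each state the
largest total that can reach it. The set that attains it is kept in the low bits of the same number:
arm `i` has weight `T i * 2 ^ m + 2 ^ i`, where `T i` is its scaled mean excess
(`KnapsackTable.Table`).

The unit is found by trying `u = 1, 2, 4, …` until the best estimate is at most `3 e u`. Failure at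
`u` implies that some set has `E[max] > e u` (`ExpMax.lt_of_not_passes`), so at the first success the
optimum is zero or at least `e u / 2`, and the set found is optimal up to a relative error of `12 / e`
(`ExpMax.approx_of_passes`). Lengths are scaled so that `u = 1` is small enough to start with, and
since failure bounds `u` by the largest value, linearly many units are tried.

For the running time, `RAM.Runs R H` states total correctness together with the invariant that all
cells have at most `R` bits; when each loop makes at most `H` iterations each time it is entered, the
time is at most `R + 1` times a polynomial in `H` that is read off the program text. -/

/-! ### Programs and their running time -/

namespace RAM

/-! Arithmetic notation for expressions. -/

instance : Add Expr := ⟨.add⟩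
instance : Sub Expr := ⟨.sub⟩
instance : Mul Expr := ⟨.mul⟩
instance : Div Expr := ⟨.div⟩
instance (n : ℕ) : OfNat Expr n := ⟨.const n⟩

namespace Expr

/-- The program variable `a`: cell `0` of array `a`. -/
def var (a : ℕ) : Expr := .get a 0

/-- `e₁ + … + eₙ`, written out. -/
def sum (f : ℕ → Expr) : ℕ → Expr
  | 0 => 0
  | n + 1 => sum f n + f n

/-- `e * … * e` with `n` factors, written out. -/
def pow (e : Expr) : ℕ → Expr
  | 0 => 1
  | n + 1 => pow e n * e

variable (σ : State) (e e₁ e₂ : Expr)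

@[simp] theorem eval_add : (e₁ + e₂).eval σ = e₁.eval σ + e₂.eval σ := rfl
@[simp] theorem eval_sub : (e₁ - e₂).eval σ = e₁.eval σ - e₂.eval σ := rfl
@[simp] theorem eval_mul : (e₁ * e₂).eval σ = e₁.eval σ * e₂.eval σ := rfl
@[simp] theorem eval_div : (e₁ / e₂).eval σ = e₁.eval σ / e₂.eval σ := rfl
@[simp] theorem eval_ofNat (n : ℕ) : (no_index (OfNat.ofNat n) : Expr).eval σ = n := rfl
@[simp] theorem eval_const (n : ℕ) : (const n).eval σ = n := rfl
@[simp] theorem eval_get (a : ℕ) : (get a e).eval σ = σ a (e.eval σ) := rfl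
@[simp] theorem eval_var (a : ℕ) : (var a).eval σ = σ a 0 := rfl

@[simp] theorem eval_sum (f : ℕ → Expr) (n : ℕ) :
    (sum f n).eval σ = ∑ j ∈ Finset.range n, (f j).eval σ := by
  induction n with
  | zero => rfl
  | succ n ih => rw [Finset.sum_range_succ, ← ih]; rfl

@[simp] theorem eval_pow (n : ℕ) : (pow e n).eval σ = e.eval σ ^ n := by
  induction n with
  | zero => rfl
  | succ n ih => rw [pow_succ, ← ih]; rfl

/-- A constant `w` such that cost and value size of the expression are at most `w * (R + 1)`
in every memory whose cells have at most `R` bits. -/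
def weight : Expr → ℕ
  | .const n => 1 + n.size
  | .get _ idx => 2 * idx.weight + 2
  | .add e₁ e₂ => 2 * (e₁.weight + e₂.weight) + 1
  | .sub e₁ e₂ => 2 * (e₁.weight + e₂.weight) + 1
  | .mul e₁ e₂ => 2 * (e₁.weight + e₂.weight) + 1
  | .div e₁ e₂ => 2 * (e₁.weight + e₂.weight) + 1

end Expr

/-! ### Reasoning about time and correctness together -/

/-- Every cell holds a number of at most `R` bits. -/
def Bdd (R : ℕ) (σ : State) : Prop := ∀ a i, (σ a i).size ≤ R

theorem size_add_le (a b : ℕ) : (a + b).size ≤ a.size + b.size + 1 := by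
  rw [Nat.size_le]
  have ha := Nat.lt_size_self a
  have hb := Nat.lt_size_self b
  have h1 : 2 ^ a.size ≤ 2 ^ (a.size + b.size) := Nat.pow_le_pow_right (by norm_num) (by omega)
  have h2 : 2 ^ b.size ≤ 2 ^ (a.size + b.size) := Nat.pow_le_pow_right (by norm_num) (by omega)
  rw [pow_succ]
  omega

theorem size_mul_le (a b : ℕ) : (a * b).size ≤ a.size + b.size := by
  rw [Nat.size_le, pow_add]
  exact Nat.mul_lt_mul'' (Nat.lt_size_self a) (Nat.lt_size_self b)

theorem Expr.weight_spec {R : ℕ} {σ : State} (h : Bdd R σ) (e : Expr) :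
    e.cost σ ≤ e.weight * (R + 1) ∧ (e.eval σ).size ≤ e.weight * (R + 1) := by
  induction e with
  | const n =>
    simp only [Expr.cost, Expr.eval, Expr.weight]
    constructor <;> nlinarith [Nat.zero_le R, Nat.zero_le n.size, Nat.zero_le (R * n.size)]
  | get a idx ih =>
    have := h a (idx.eval σ)
    simp only [Expr.cost, Expr.eval, Expr.weight]
    constructor <;> nlinarith [ih.1, ih.2, Nat.zero_le (idx.weight * (R + 1))]
  | add e₁ e₂ ih₁ ih₂ =>
    have := size_add_le (e₁.eval σ) (e₂.eval σ)
    simp only [Expr.cost, Expr.eval, Expr.weight]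
    constructor <;> nlinarith [ih₁.1, ih₁.2, ih₂.1, ih₂.2]
  | sub e₁ e₂ ih₁ ih₂ =>
    have := Nat.size_le_size (Nat.sub_le (e₁.eval σ) (e₂.eval σ))
    simp only [Expr.cost, Expr.eval, Expr.weight]
    constructor <;> nlinarith [ih₁.1, ih₁.2, ih₂.1, ih₂.2]
  | mul e₁ e₂ ih₁ ih₂ =>
    have := size_mul_le (e₁.eval σ) (e₂.eval σ)
    simp only [Expr.cost, Expr.eval, Expr.weight]
    constructor <;> nlinarith [ih₁.1, ih₁.2, ih₂.1, ih₂.2]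
  | div e₁ e₂ ih₁ ih₂ =>
    have := Nat.size_le_size (Nat.div_le_self (e₁.eval σ) (e₂.eval σ))
    simp only [Expr.cost, Expr.eval, Expr.weight]
    constructor <;> nlinarith [ih₁.1, ih₁.2, ih₂.1, ih₂.2]

/-- A bound on the running time, in units of `R + 1`, when cells have at most `R` bits and every
loop, each time it is entered, makes at most `H` iterations. It is a polynomial in `H`. -/
noncomputable def Cmd.time : Cmd → Polynomial ℕ
  | .skip => 1
  | .set _ idx e => Polynomial.C (2 * idx.weight + 2 * e.weight + 1)
  | .seq c₁ c₂ => c₁.time + c₂.time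
  | .ite e c₁ c₂ => Polynomial.C (2 * e.weight + 1) + c₁.time + c₂.time
  | .while e c => (Polynomial.X + 1) * (Polynomial.C (2 * e.weight + 1) + c.time)

/-- Total correctness with resource bounds: started in `σ` with cells of at most `R` bits, `c` halts
within time `c.time H * (R + 1)` in a state that satisfies `Q`, with cells of at most `R` bits. -/
def Runs (R H : ℕ) (c : Cmd) (σ : State) (Q : State → Prop) : Prop :=
  Bdd R σ → ∃ t σ', Exec c σ t σ' ∧ t ≤ c.time.eval H * (R + 1) ∧ Bdd R σ' ∧ Q σ'

namespace Runs

variable {R H : ℕ} {σ : State} {Q Q' : State → Prop}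

theorem mono {c : Cmd} (h : Runs R H c σ Q') (hQ : ∀ σ', Q' σ' → Q σ') : Runs R H c σ Q :=
  fun hb => let ⟨t, σ', h₁, h₂, h₃, h₄⟩ := h hb; ⟨t, σ', h₁, h₂, h₃, hQ _ h₄⟩

theorem skip (h : Q σ) : Runs R H .skip σ Q :=
  fun hb => ⟨1, σ, .skip σ, by simp [Cmd.time], hb, h⟩

theorem set {a : ℕ} {idx e : Expr} (hs : (e.eval σ).size ≤ R)
    (h : Q (σ.write a (idx.eval σ) (e.eval σ))) : Runs R H (.set a idx e) σ Q := by
  intro hb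
  refine ⟨_, _, .set a idx e σ, ?_, fun a' i' => ?_, h⟩
  · have h₁ := idx.weight_spec hb
    have h₂ := e.weight_spec hb
    simp only [Cmd.time, Polynomial.eval_C]
    nlinarith
  · unfold State.write
    split_ifs
    exacts [hs, hb a' i']

theorem seq {c₁ c₂ : Cmd} (h : Runs R H c₁ σ fun σ' => Runs R H c₂ σ' Q) :
    Runs R H (.seq c₁ c₂) σ Q := by
  intro hb
  obtain ⟨t₁, σ₁, h₁, ht₁, hb₁, h⟩ := h hb
  obtain ⟨t₂, σ₂, h₂, ht₂, hb₂, h⟩ := h hb₁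
  refine ⟨_, _, .seq h₁ h₂, ?_, hb₂, h⟩
  simp only [Cmd.time, Polynomial.eval_add]
  nlinarith

theorem ite {e : Expr} {c₁ c₂ : Cmd} (h₁ : e.eval σ ≠ 0 → Runs R H c₁ σ Q)
    (h₂ : e.eval σ = 0 → Runs R H c₂ σ Q) : Runs R H (.ite e c₁ c₂) σ Q := by
  intro hb
  have he := e.weight_spec hb
  by_cases hc : e.eval σ = 0
  · obtain ⟨t, σ', h, ht, hb', hq⟩ := h₂ hc hb
    refine ⟨_, _, .ite_false hc h, ?_, hb', hq⟩
    simp only [Cmd.time, Polynomial.eval_add, Polynomial.eval_C]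
    nlinarith [Nat.zero_le (c₁.time.eval H * (R + 1))]
  · obtain ⟨t, σ', h, ht, hb', hq⟩ := h₁ hc hb
    refine ⟨_, _, .ite_true hc h, ?_, hb', hq⟩
    simp only [Cmd.time, Polynomial.eval_add, Polynomial.eval_C]
    nlinarith [Nat.zero_le (c₂.time.eval H * (R + 1))]

/-- The rule for a loop; `k` bounds the number of iterations that are still to come. -/
theorem loop {e : Expr} {c : Cmd} (Inv : ℕ → State → Prop) {n : ℕ} (hn : n ≤ H) (h : Inv n σ)
    (hexit : ∀ k τ, Inv k τ → e.eval τ = 0 → Q τ)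
    (hstep : ∀ k τ, k ≤ n → Inv k τ → e.eval τ ≠ 0 → 0 < k ∧ Runs R H c τ (Inv (k - 1))) :
    Runs R H (.while e c) σ Q := by
  have key : ∀ k τ, k ≤ n → Inv k τ → Bdd R τ → ∃ t τ', Exec (.while e c) τ t τ' ∧
      t ≤ (k + 1) * (2 * e.weight + 1 + c.time.eval H) * (R + 1) ∧ Bdd R τ' ∧ Q τ' := by
    intro k
    induction k with
    | zero =>
      intro τ hk hi hb
      have he := e.weight_spec hb
      by_cases hc : e.eval τ = 0
      · refine ⟨_, _, .while_false hc, ?_, hb, hexit _ _ hi hc⟩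
        nlinarith [Nat.zero_le (c.time.eval H * (R + 1))]
      · exact absurd (hstep 0 τ hk hi hc).1 (by simp)
    | succ k ih =>
      intro τ hk hi hb
      have he := e.weight_spec hb
      by_cases hc : e.eval τ = 0
      · refine ⟨_, _, .while_false hc, ?_, hb, hexit _ _ hi hc⟩
        nlinarith [Nat.zero_le (c.time.eval H * (R + 1)),
          Nat.zero_le ((k + 1) * (2 * e.weight + 1 + c.time.eval H) * (R + 1))]
      · obtain ⟨t₁, τ₁, h₁, ht₁, hb₁, hi₁⟩ := (hstep _ τ hk hi hc).2 hb
        obtain ⟨t₂, τ₂, h₂, ht₂, hb₂, hq⟩ := ih τ₁ (by omega) hi₁ hb₁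
        refine ⟨_, _, .while_true hc h₁ h₂, ?_, hb₂, hq⟩
        nlinarith
  intro hb
  obtain ⟨t, σ', h₁, ht, hb', hq⟩ := key n σ le_rfl h hb
  refine ⟨t, σ', h₁, ht.trans (Nat.mul_le_mul_right _ ?_), hb', hq⟩
  simp only [Cmd.time, Polynomial.eval_add, Polynomial.eval_C, Polynomial.eval_mul,
    Polynomial.eval_X, Polynomial.eval_one]
  exact Nat.mul_le_mul_right _ (by omega)

end Runs

/-- The assignment `x := e` to a program variable. -/
def Cmd.assign (x : ℕ) (e : Expr) : Cmd := .set x 0 e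

/-- Execute `c` as often as the variable `x` says, counting `x` down to zero. -/
def Cmd.countdown (x : ℕ) (c : Cmd) : Cmd :=
  .while (.var x) (.seq (.assign x (.var x - 1)) c)

/-- The assignments `a[0] := f 0; …; a[n - 1] := f (n - 1)`, written out. -/
def Cmd.fill (a : ℕ) (f : ℕ → Expr) : ℕ → Cmd
  | 0 => .skip
  | n + 1 => .seq (fill a f n) (.set a (.const n) (f n))

namespace Runs

variable {R H : ℕ} {σ : State} {Q : State → Prop}

theorem assign {x : ℕ} {e : Expr} (hs : (e.eval σ).size ≤ R) (h : Q (σ.write x 0 (e.eval σ))) :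
    Runs R H (.assign x e) σ Q := set hs h

theorem assign_seq {x : ℕ} {e : Expr} {c : Cmd} (hs : (e.eval σ).size ≤ R)
    (h : Runs R H c (σ.write x 0 (e.eval σ)) Q) : Runs R H (.seq (.assign x e) c) σ Q :=
  seq (assign hs h)

theorem countdown {x n : ℕ} {c : Cmd} (Inv : ℕ → State → Prop) (hn : n ≤ H) (hx : σ x 0 = n)
    (h : Inv n σ)
    (hstep : ∀ k τ, k < n → Inv (k + 1) τ → τ x 0 = k + 1 →
      Runs R H c (τ.write x 0 k) fun τ' => Inv k τ' ∧ τ' x 0 = k)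
    (hexit : ∀ τ, Inv 0 τ → τ x 0 = 0 → Q τ) : Runs R H (.countdown x c) σ Q := by
  refine Runs.loop (fun k τ => Inv k τ ∧ τ x 0 = k) hn ⟨h, hx⟩ ?_ ?_
  · rintro k τ ⟨hi, hk⟩ hc
    have : k = 0 := by simpa [hk] using hc
    subst this
    exact hexit τ hi hk
  · rintro k τ hkn ⟨hi, hk⟩ hc
    have hk0 : k ≠ 0 := by simpa [hk] using hc
    obtain ⟨k, rfl⟩ := Nat.exists_eq_succ_of_ne_zero hk0
    refine ⟨by omega, seq ?_⟩
    intro hb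
    refine assign (le_trans (Nat.size_le_size (Nat.sub_le (τ x 0) 1)) (hb x 0)) ?_ hb
    have := hstep k τ (by omega) hi hk
    simpa [hk] using this

/-- The rule `countdown` with an invariant indexed by the number of iterations made so far. -/
theorem countdown_up {x n : ℕ} {c : Cmd} (Inv : ℕ → State → Prop) (hn : n ≤ H) (hx : σ x 0 = n)
    (h : Inv 0 σ)
    (hstep : ∀ j τ, j < n → Inv j τ →
      Runs R H c (τ.write x 0 (n - (j + 1))) fun τ' => Inv (j + 1) τ' ∧ τ' x 0 = n - (j + 1))
    (hexit : ∀ τ, Inv n τ → τ x 0 = 0 → Q τ) : Runs R H (.countdown x c) σ Q := by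
  refine countdown (fun k τ => k ≤ n ∧ Inv (n - k) τ) hn hx ⟨le_rfl, by simpa using h⟩ ?_ ?_
  · rintro k τ hk ⟨_, hi⟩ _
    have := hstep (n - (k + 1)) τ (by omega) hi
    have e₁ : n - (k + 1) + 1 = n - k := by omega
    have e₂ : n - (n - k) = k := by omega
    rw [e₁, e₂] at this
    exact this.mono fun τ' h' => ⟨⟨hk.le, h'.1⟩, h'.2⟩
  · rintro τ ⟨_, hi⟩ h0
    exact hexit τ (by simpa using hi) h0

/-- The expressions `f j` may read cells of `a` that have not been overwritten yet; `g j` is the value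
of `f j` at the time of its assignment. -/
theorem fill {a n : ℕ} {f : ℕ → Expr} (g : ℕ → ℕ)
    (hf : ∀ j < n, ∀ τ : State, (∀ a' i, a' ≠ a ∨ j ≤ i → τ a' i = σ a' i) → (f j).eval τ = g j)
    (hg : ∀ j < n, (g j).size ≤ R)
    (h : Q fun a' i => if a' = a ∧ i < n then g i else σ a' i) :
    Runs R H (.fill a f n) σ Q := by
  induction n generalizing Q with
  | zero => exact skip (by simpa using h)
  | succ n ih =>
    refine seq (ih (fun j hj => hf j (by omega)) (fun j hj => hg j (by omega)) ?_)
    have hv := hf n (by omega) (fun a' i => if a' = a ∧ i < n then g i else σ a' i)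
      (fun a' i h => if_neg (by omega))
    refine set (by rw [hv]; exact hg n (by omega)) ?_
    convert h using 1
    funext a' i
    simp only [State.write, hv, Expr.eval_const]
    by_cases ha : a' = a <;> by_cases hi : i = n
    · simp [ha, hi]
    · simp only [ha, hi, and_false, if_false, true_and]
      exact if_congr (by omega) rfl rfl
    · simp [ha]
    · simp [ha]

end Runs

end RAM

/-! ### Digits -/

namespace KnapsackTable

/-- The digit at position `j` of `z` in base `b`. -/
def digit (b j z : ℕ) : ℕ := z / b ^ j % b

theorem sum_digits_lt {b : ℕ} {c : ℕ → ℕ} (L : ℕ) (hc : ∀ j < L, c j < b) :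
    ∑ j ∈ Finset.range L, c j * b ^ j < b ^ L := by
  induction L with
  | zero => simp
  | succ L ih =>
    have h₁ := ih fun j hj => hc j (by omega)
    have h₂ : (c L + 1) * b ^ L ≤ b * b ^ L := Nat.mul_le_mul_right _ (hc L (by omega))
    rw [Finset.sum_range_succ, pow_succ']
    linarith

theorem digits_div {b : ℕ} {c : ℕ → ℕ} (L k : ℕ) (hc : ∀ j < L, c j < b) :
    (∑ j ∈ Finset.range L, c j * b ^ j + k * b ^ L) / b ^ L = k := by
  have h := sum_digits_lt L hc
  rw [Nat.add_mul_div_right _ _ (by omega), Nat.div_eq_of_lt h, zero_add]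

theorem digit_digits {b : ℕ} {c : ℕ → ℕ} (L k : ℕ) (hc : ∀ j < L, c j < b) {i : ℕ} (hi : i < L) :
    digit b i (∑ j ∈ Finset.range L, c j * b ^ j + k * b ^ L) = c i := by
  induction L generalizing k with
  | zero => omega
  | succ L ih =>
    rw [Finset.sum_range_succ, pow_succ, add_assoc,
      show c L * b ^ L + k * (b ^ L * b) = (c L + k * b) * b ^ L by ring]
    rcases Nat.lt_succ_iff_lt_or_eq.1 hi with h | rfl
    · exact ih _ (fun j hj => hc j (by omega)) h
    · unfold digit
      rw [digits_div _ _ fun j hj => hc j (by omega), Nat.add_mul_mod_self_right,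
        Nat.mod_eq_of_lt (hc _ (by omega))]

/-! ### The table of the dynamic program -/

/-- The state that a chosen arm leads to: `z` encodes a counter on top of `L` digits in base `b`;
digit `j` is multiplied by `q j / D` and rounded down, and the counter is incremented. -/
def shift (b L D : ℕ) (q : ℕ → ℕ) (z : ℕ) : ℕ :=
  ∑ j ∈ Finset.range L, (digit b j z * q j / D) * b ^ j + (z / b ^ L + 1) * b ^ L

section shift

variable {b L D : ℕ} {q : ℕ → ℕ} (hb : 0 < b) (hq : ∀ j < L, q j ≤ D) (z : ℕ)

include hb hq in
theorem shift_digit_lt {j : ℕ} (hj : j < L) : digit b j z * q j / D < b :=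
  (Nat.div_le_of_le_mul (by rw [mul_comm]; exact Nat.mul_le_mul_right _ (hq j hj))).trans_lt
    (Nat.mod_lt _ hb)

include hb hq in
theorem digit_shift {j : ℕ} (hj : j < L) :
    digit b j (shift b L D q z) = digit b j z * q j / D :=
  digit_digits L _ (fun _ h => shift_digit_lt hb hq z h) hj

include hb hq in
theorem shift_div : shift b L D q z / b ^ L = z / b ^ L + 1 :=
  digits_div L _ fun _ h => shift_digit_lt hb hq z h

include hb in
/-- States only move upwards, so that processing them in descending order in place uses every arm at
most once. -/
theorem lt_shift : z < shift b L D q z := by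
  have h₁ : z < (z / b ^ L + 1) * b ^ L := by
    rw [add_mul, one_mul]
    exact Nat.lt_div_mul_add (by positivity)
  unfold shift
  omega

include hb hq in
theorem shift_lt {k : ℕ} (h : z < k * b ^ L) : shift b L D q z < (k + 1) * b ^ L := by
  have h₁ := sum_digits_lt (c := fun j => digit b j z * q j / D) L
    fun _ h => shift_digit_lt hb hq z h
  have h₂ : (z / b ^ L + 1) * b ^ L ≤ k * b ^ L :=
    Nat.mul_le_mul_right _ (Nat.succ_le_of_lt ((Nat.div_lt_iff_lt_mul (by positivity)).2 h))
  unfold shift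
  rw [add_mul k, one_mul]
  omega

end shift

/-- The state reached from `z₀` by those of the arms `0, …, i - 1` that lie in `S`. -/
def reach (tr : ℕ → ℕ → ℕ) (z₀ : ℕ) (S : Finset ℕ) : ℕ → ℕ
  | 0 => z₀
  | i + 1 => if i ∈ S then tr i (reach tr z₀ S i) else reach tr z₀ S i

/-- The table after the first `i` arms: a nonzero entry is `w₀` plus the total weight of a set that
reaches the state, and no such set is heavier. -/
structure Table (tr : ℕ → ℕ → ℕ) (w : ℕ → ℕ) (z₀ w₀ bound : ℕ) (i : ℕ) (T : ℕ → ℕ) : Prop where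
  sound : ∀ z, T z ≠ 0 → ∃ S ⊆ Finset.range i, reach tr z₀ S i = z ∧ T z = w₀ + ∑ a ∈ S, w a
  complete : ∀ S ⊆ Finset.range i, S.card ≤ bound →
    w₀ + ∑ a ∈ S, w a ≤ T (reach tr z₀ S i)

/-- Halfway through the update of the table `T₀` for an arm with transition `tr` and weight `w`:
the states in `[x, X)` have been used. -/
structure Partial (tr : ℕ → ℕ) (w X : ℕ) (T₀ : ℕ → ℕ) (x : ℕ) (T : ℕ → ℕ) : Prop where
  eq : ∀ z ≤ x, T z = T₀ z
  le : ∀ z, T₀ z ≤ T z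
  used : ∀ z, x ≤ z → z < X → T₀ z ≠ 0 → T₀ z + w ≤ T (tr z)
  sound : ∀ z, T z ≠ 0 → T z = T₀ z ∨ ∃ z' < X, T₀ z' ≠ 0 ∧ tr z' = z ∧ T z = T₀ z' + w

theorem Partial.init (tr : ℕ → ℕ) (w X : ℕ) (T₀ : ℕ → ℕ) : Partial tr w X T₀ X T₀ :=
  ⟨fun _ _ => rfl, fun _ => le_rfl, fun z h₁ h₂ => by omega, fun _ _ => .inl rfl⟩

theorem Partial.step_zero {tr : ℕ → ℕ} {w X x : ℕ} {T₀ T : ℕ → ℕ}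
    (h : Partial tr w X T₀ (x + 1) T) (h0 : T x = 0) : Partial tr w X T₀ x T where
  eq z hz := h.eq z (by omega)
  le := h.le
  used z hz hX hT := by
    rcases hz.eq_or_lt with rfl | hz
    · exact absurd ((h.eq x (by omega)).symm.trans h0) hT
    · exact h.used z hz hX hT
  sound := h.sound

theorem Partial.step {tr : ℕ → ℕ} {w X x : ℕ} {T₀ T : ℕ → ℕ} (hx : x < X)
    (h : Partial tr w X T₀ (x + 1) T) (h0 : T x ≠ 0) (htr : x < tr x) :
    Partial tr w X T₀ x (Function.update T (tr x) (max (T (tr x)) (T x + w))) where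
  eq z hz := by
    rw [Function.update_of_ne (by omega)]
    exact h.eq z (by omega)
  le z := by
    by_cases hz : z = tr x
    · subst hz
      rw [Function.update_self]
      exact (h.le _).trans (le_max_left _ _)
    · rw [Function.update_of_ne hz]
      exact h.le z
  used z hz hX hT := by
    have hTx := h.eq x (by omega)
    rcases hz.eq_or_lt with rfl | hz
    · rw [Function.update_self, ← hTx]
      exact le_max_right _ _
    · have := h.used z hz hX hT
      by_cases e : tr z = tr x
      · rw [e] at this ⊢
        rw [Function.update_self]
        exact this.trans (le_max_left _ _)
      · rwa [Function.update_of_ne e]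
  sound z hz := by
    have hTx := h.eq x (by omega)
    by_cases e : z = tr x
    · subst e
      rw [Function.update_self] at hz ⊢
      rcases le_total (T (tr x)) (T x + w) with hm | hm
      · rw [max_eq_right hm]
        exact .inr ⟨x, hx, hTx ▸ h0, rfl, by rw [hTx]⟩
      · rw [max_eq_left hm] at hz ⊢
        exact h.sound _ hz
    · rw [Function.update_of_ne e] at hz ⊢
      exact h.sound z hz

theorem reach_congr {tr : ℕ → ℕ → ℕ} {z₀ : ℕ} {S S' : Finset ℕ} {i : ℕ}
    (h : ∀ a < i, a ∈ S ↔ a ∈ S') : reach tr z₀ S i = reach tr z₀ S' i := by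
  induction i with
  | zero => rfl
  | succ i ih =>
    simp only [reach, ih fun a ha => h a (by omega), h i (by omega)]

theorem Table.init {tr : ℕ → ℕ → ℕ} {w : ℕ → ℕ} {z₀ w₀ bound : ℕ} :
    Table tr w z₀ w₀ bound 0 (Function.update 0 z₀ w₀) where
  sound z hz := by
    by_cases h : z = z₀
    · exact ⟨∅, by simp, by simp [reach, h], by simp [h]⟩
    · simp [h] at hz
  complete S hS _ := by
    obtain rfl : S = ∅ := by simpa using hS
    simp [reach]

theorem Table.succ {tr : ℕ → ℕ → ℕ} {w : ℕ → ℕ} {z₀ w₀ bound i X : ℕ} {T₀ T : ℕ → ℕ}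
    (h₀ : Table tr w z₀ w₀ bound i T₀) (hw : 0 < w₀) (h : Partial (tr i) (w i) X T₀ 0 T)
    (hX : ∀ S ⊆ Finset.range i, S.card < bound → reach tr z₀ S i < X) :
    Table tr w z₀ w₀ bound (i + 1) T where
  sound z hz := by
    rcases h.sound z hz with hT | ⟨z', _, hz', rfl, hT⟩
    · obtain ⟨S, hS, rfl, hw⟩ := h₀.sound z (hT ▸ hz)
      have hi : i ∉ S := fun h => by simpa using hS h
      refine ⟨S, hS.trans (by simp), by simp [reach, hi], hT.trans hw⟩
    · obtain ⟨S, hS, rfl, hw⟩ := h₀.sound z' hz'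
      have hi : i ∉ S := fun h => by simpa using hS h
      refine ⟨insert i S, ?_, ?_, ?_⟩
      · rw [Finset.range_add_one]
        exact Finset.insert_subset_insert i hS
      · rw [reach, if_pos (by simp)]
        congr 1
        exact reach_congr fun a ha => by simp [ha.ne]
      · rw [hT, hw, Finset.sum_insert hi]
        ring
  complete S hS hc := by
    by_cases hi : i ∈ S
    · have hS' : S.erase i ⊆ Finset.range i := by
        intro a ha
        rw [Finset.mem_erase] at ha
        have := Finset.mem_range.1 (hS ha.2)
        rw [Finset.mem_range]
        omega
      have hc' := Finset.card_erase_of_mem hi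
      have hpos := Finset.card_pos.2 ⟨i, hi⟩
      have h₁ := h₀.complete _ hS' (by omega)
      have e : reach tr z₀ (S.erase i) i = reach tr z₀ S i :=
        reach_congr fun a ha => by simp [ha.ne]
      have h₂ := h.used _ (Nat.zero_le _) (hX _ hS' (by omega)) (by omega)
      rw [reach, if_pos hi, ← Finset.sum_erase_add _ _ hi, ← e]
      omega
    · have hS' : S ⊆ Finset.range i := by
        intro a ha
        have := Finset.mem_range.1 (hS ha)
        rw [Finset.mem_range]
        have : a ≠ i := fun h => hi (h ▸ ha)
        omega
      rw [reach, if_neg hi]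
      exact (h₀.complete S hS' hc).trans (h.le _)

section reach

variable {b L D : ℕ} {q : ℕ → ℕ → ℕ} (hb : 0 < b) {S : Finset ℕ} {m : ℕ}
  (hq : ∀ i < m, ∀ j < L, q i j ≤ D)

/-- The empty product: all digits equal `b - 1` and the counter is `0`. -/
theorem start_eq (b L : ℕ) (hb : 0 < b) :
    b ^ L - 1 = ∑ j ∈ Finset.range L, (b - 1) * b ^ j + 0 * b ^ L := by
  rw [zero_mul, add_zero]
  induction L with
  | zero => simp
  | succ L ih =>
    rw [Finset.sum_range_succ]
    have : (b - 1) * b ^ L + b ^ L = b ^ (L + 1) := by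
      rw [pow_succ', ← Nat.succ_mul, Nat.succ_eq_add_one, Nat.sub_add_cancel hb]
    have : 0 < b ^ L := by positivity
    omega

include hb hq in
/-- The counter of the reached state is the number of chosen arms. -/
theorem reach_div : reach (fun i => shift b L D (q i)) (b ^ L - 1) S m / b ^ L =
    (S ∩ Finset.range m).card := by
  induction m with
  | zero =>
    rw [reach, start_eq b L hb, digits_div _ _ fun _ _ => by omega]
    simp
  | succ m ih =>
    have ih := ih fun i hi => hq i (by omega)
    rw [reach, Finset.range_add_one]
    split_ifs with h
    · rw [shift_div hb (hq m (by omega)), ih, Finset.inter_insert_of_mem h,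
        Finset.card_insert_of_notMem (by simp)]
    · rw [ih, Finset.inter_insert_of_notMem h]

include hb hq in
/-- The digits of the reached state are the scaled products of the `q i j / D`, up to one unit for
each rounding. -/
theorem digit_reach {j : ℕ} (hj : j < L) :
    (digit b j (reach (fun i => shift b L D (q i)) (b ^ L - 1) S m) : ℝ) ≤
      (b - 1 : ℕ) * ∏ i ∈ S ∩ Finset.range m, (q i j / D : ℝ) ∧
    (b - 1 : ℕ) * ∏ i ∈ S ∩ Finset.range m, (q i j / D : ℝ) - (S ∩ Finset.range m).card ≤
      digit b j (reach (fun i => shift b L D (q i)) (b ^ L - 1) S m) := by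
  induction m with
  | zero =>
    rw [reach, start_eq b L hb, digit_digits _ _ (fun _ _ => by omega) hj]
    simp
  | succ m ih =>
    obtain ⟨h₁, h₂⟩ := ih fun i hi => hq i (by omega)
    rw [reach, Finset.range_add_one]
    split_ifs with h
    · rw [digit_shift hb (hq m (by omega)) _ hj, Finset.inter_insert_of_mem h,
        Finset.card_insert_of_notMem (by simp), Finset.prod_insert (by simp)]
      set d := digit b j (reach (fun i => shift b L D (q i)) (b ^ L - 1) S m)
      have hq0 : (0 : ℝ) ≤ q m j / D := by positivity
      have hq1 : (q m j / D : ℝ) ≤ 1 :=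
        div_le_one_of_le₀ (by exact_mod_cast hq m (by omega) j hj) (by positivity)
      have h₃ : ((d * q m j / D : ℕ) : ℝ) ≤ d * (q m j / D) := by
        refine Nat.cast_div_le.trans_eq ?_
        push_cast
        ring
      have h₄ : (d * (q m j / D) : ℝ) - 1 ≤ ((d * q m j / D : ℕ) : ℝ) := by
        have := Nat.lt_floor_add_one ((d * q m j : ℕ) / (D : ℝ))
        rw [Nat.floor_div_eq_div] at this
        push_cast at this
        rw [mul_div_assoc] at this
        linarith
      push_cast
      constructor
      · nlinarith
      · nlinarith [Nat.cast_nonneg (α := ℝ) (S ∩ Finset.range m).card]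
    · rw [Finset.inter_insert_of_notMem h]
      exact ⟨h₁, h₂⟩

end reach

end KnapsackTable

open MeasureTheory

/-! ### Layers -/

/-- The sum of the steps at heights `u, 2u, …, Lu` that lie below `x`. -/
theorem sum_steps_le (u x : ℝ) (hx : 0 ≤ x) (L : ℕ) :
    ∑ j ∈ Finset.range L, (if (j + 1) * u ≤ x then u else 0) ≤ min x (L * u) := by
  induction L with
  | zero => simp [hx]
  | succ L ih =>
    rw [Finset.sum_range_succ]
    push_cast
    have h1 := ih.trans (min_le_left _ _)
    have h2 := ih.trans (min_le_right _ _)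
    split_ifs with h
    · exact le_min (by linarith) (by linarith)
    · exact le_min (by linarith) (by linarith)

theorem min_le_sum_steps (u x : ℝ) (hu : 0 ≤ u) (L : ℕ) :
    min x (L * u) ≤ ∑ j ∈ Finset.range L, (if (j + 1) * u ≤ x then u else 0) + u := by
  suffices H : (L * u ≤ x → ∑ j ∈ Finset.range L, (if (j + 1) * u ≤ x then u else 0) = L * u) ∧
      min x (L * u) ≤ ∑ j ∈ Finset.range L, (if (j + 1) * u ≤ x then u else 0) + u from H.2
  induction L with
  | zero => simp [hu]
  | succ L ih =>
    rw [Finset.sum_range_succ]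
    push_cast
    split_ifs with h
    · have := ih.1 (by linarith)
      refine ⟨fun _ => by linarith, (min_le_right _ _).trans (by linarith)⟩
    · refine ⟨fun h' => absurd h' h, (min_le_left _ _).trans ?_⟩
      by_cases hL : L * u ≤ x
      · have := ih.1 hL
        linarith
      · have := ih.2
        rw [min_eq_left (by linarith)] at this
        linarith

/-! ### The expected maximum of independent variables and its surrogate -/

namespace ExpMax

variable {ι : Type*} [Fintype ι] (μ : ι → Measure ℝ≥0) [∀ i, IsProbabilityMeasure (μ i)]

/-- The mean excess over the threshold `B`. -/
noncomputable def excess (ν : Measure ℝ≥0) (B : ℝ) : ℝ := ∫ y, max ((y : ℝ) - B) 0 ∂ν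

/-- The surrogate for the expected maximum over `S`: the layers of height `u` below `L u`, and
above `L u` the sum of the individual mean excesses. -/
noncomputable def surrogate (u : ℝ) (L : ℕ) (S : Finset ι) : ℝ :=
  ∑ j ∈ Finset.range L, u * (1 - ∏ i ∈ S, (μ i).real {y | (y : ℝ) < (j + 1) * u}) +
    ∑ i ∈ S, excess (μ i) (L * u)

theorem excess_nonneg (ν : Measure ℝ≥0) (B : ℝ) : 0 ≤ excess ν B :=
  integral_nonneg fun _ => le_max_right _ _

variable {μ} {C : ℝ≥0} (hC : ∀ i, ∀ᵐ y ∂μ i, y ≤ C) (S : Finset ι)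

include hC in
theorem ae_le : ∀ᵐ x ∂Measure.pi μ, ∀ i, x i ≤ C := by
  rw [ae_all_iff]
  exact fun i => (measurePreserving_eval μ i).quasiMeasurePreserving.ae (hC i)

omit [Fintype ι] in
theorem measurable_sup : Measurable fun x : ι → ℝ≥0 => S.sup x := by
  classical
  induction S using Finset.induction_on with
  | empty => simp
  | insert a S _ ih =>
    simp only [Finset.sup_insert]
    exact (measurable_pi_apply a).sup ih

include hC in
theorem integrable_sup : Integrable (fun x : ι → ℝ≥0 => ((S.sup x : ℝ≥0) : ℝ)) (Measure.pi μ) := by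
  refine Integrable.of_bound (C := C)
    (measurable_sup S).coe_nnreal_real.aestronglyMeasurable ?_
  filter_upwards [ae_le hC] with x hx
  simpa using fun i _ => hx i

include hC in
theorem integrable_excess (i : ι) (B : ℝ) :
    Integrable (fun x : ι → ℝ≥0 => max ((x i : ℝ) - B) 0) (Measure.pi μ) := by
  refine Integrable.of_bound (C := C + |B|)
    (((measurable_pi_apply i).coe_nnreal_real.sub_const B).max
      measurable_const).aestronglyMeasurable ?_
  filter_upwards [ae_le hC] with x hx
  have : (x i : ℝ) ≤ C := by exact_mod_cast hx i
  rw [Real.norm_eq_abs, abs_of_nonneg (le_max_right _ _)]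
  exact max_le (by linarith [neg_abs_le B]) (by positivity)

theorem integral_excess (i : ι) (B : ℝ) :
    ∫ x : ι → ℝ≥0, max ((x i : ℝ) - B) 0 ∂Measure.pi μ = excess (μ i) B :=
  integral_comp_eval (μ := μ) (i := i) (f := fun y : ℝ≥0 => max ((y : ℝ) - B) 0)
    (by fun_prop)

theorem measure_sup_lt {t : ℝ} (ht : 0 < t) :
    (Measure.pi μ).real {x | ((S.sup x : ℝ≥0) : ℝ) < t} =
      ∏ i ∈ S, (μ i).real {y | (y : ℝ) < t} := by
  classical
  lift t to ℝ≥0 using ht.le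
  have : {x : ι → ℝ≥0 | ((S.sup x : ℝ≥0) : ℝ) < t} =
      Set.pi Set.univ fun i => if i ∈ S then {y : ℝ≥0 | (y : ℝ) < t} else Set.univ := by
    ext x
    have ht' : (⊥ : ℝ≥0) < t := by exact_mod_cast ht
    simp only [NNReal.coe_lt_coe, Set.mem_ofPred_eq, Finset.sup_lt_iff ht', Set.mem_pi, Set.mem_univ,
      true_implies]
    refine forall_congr' fun i => ?_
    split_ifs with h <;> simp [h]
  rw [this, measureReal_def, Measure.pi_pi, ENNReal.toReal_prod,
    ← Finset.prod_subset (Finset.subset_univ S)]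
  · refine Finset.prod_congr rfl fun i hi => ?_
    simp [hi, measureReal_def]
  · intro i _ hi
    simp [hi]

theorem integral_step (u : ℝ) {t : ℝ} (ht : 0 < t) :
    Integrable (fun x : ι → ℝ≥0 => if t ≤ ((S.sup x : ℝ≥0) : ℝ) then u else 0) (Measure.pi μ) ∧
    ∫ x : ι → ℝ≥0, (if t ≤ ((S.sup x : ℝ≥0) : ℝ) then u else 0) ∂Measure.pi μ =
      u * (1 - ∏ i ∈ S, (μ i).real {y | (y : ℝ) < t}) := by
  have hm : MeasurableSet {x : ι → ℝ≥0 | t ≤ ((S.sup x : ℝ≥0) : ℝ)} :=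
    measurableSet_le measurable_const (measurable_sup S).coe_nnreal_real
  have he : (fun x : ι → ℝ≥0 => if t ≤ ((S.sup x : ℝ≥0) : ℝ) then u else 0) =
      Set.indicator {x : ι → ℝ≥0 | t ≤ ((S.sup x : ℝ≥0) : ℝ)} fun _ => u := by
    funext x
    simp [Set.indicator_apply]
  have hc : {x : ι → ℝ≥0 | t ≤ ((S.sup x : ℝ≥0) : ℝ)} =
      {x : ι → ℝ≥0 | ((S.sup x : ℝ≥0) : ℝ) < t}ᶜ := by
    ext x
    simp
  rw [he]
  refine ⟨(integrable_const u).indicator hm, ?_⟩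
  rw [integral_indicator_const u hm, ← measure_sup_lt S ht, hc, probReal_compl_eq_one_sub, smul_eq_mul, mul_comm]
  exact measurableSet_lt (measurable_sup S).coe_nnreal_real measurable_const

include hC in
/-- The surrogate loses at most one layer. -/
theorem integral_sup_le {u : ℝ} (hu : 0 < u) (L : ℕ) :
    ∫ x : ι → ℝ≥0, ((S.sup x : ℝ≥0) : ℝ) ∂Measure.pi μ ≤ surrogate μ u L S + u := by
  have hstep := fun j : ℕ => integral_step (μ := μ) S u (t := (j + 1) * u) (by positivity)
  have hi₁ : Integrable (fun x : ι → ℝ≥0 => ∑ j ∈ Finset.range L,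
      if (j + 1) * u ≤ ((S.sup x : ℝ≥0) : ℝ) then u else 0) (Measure.pi μ) :=
    integrable_finsetSum _ fun j _ => (hstep j).1
  have hi₂ : Integrable (fun x : ι → ℝ≥0 => ∑ i ∈ S, max ((x i : ℝ) - L * u) 0) (Measure.pi μ) :=
    integrable_finsetSum _ fun i _ => integrable_excess hC i _
  calc ∫ x : ι → ℝ≥0, ((S.sup x : ℝ≥0) : ℝ) ∂Measure.pi μ
      ≤ ∫ x : ι → ℝ≥0, (∑ j ∈ Finset.range L,
          if (j + 1) * u ≤ ((S.sup x : ℝ≥0) : ℝ) then u else 0) +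
            (∑ i ∈ S, max ((x i : ℝ) - L * u) 0) + u ∂Measure.pi μ := by
        refine integral_mono (integrable_sup hC S) ((hi₁.add hi₂).add (integrable_const u))
          fun x => ?_
        have h₁ := min_le_sum_steps u ((S.sup x : ℝ≥0) : ℝ) hu.le L
        have h₂ : ((S.sup x : ℝ≥0) : ℝ) - L * u ≤ ∑ i ∈ S, max ((x i : ℝ) - L * u) 0 ∨
            ((S.sup x : ℝ≥0) : ℝ) ≤ L * u := by
          rcases S.eq_empty_or_nonempty with rfl | hS
          · right
            simp only [Finset.sup_empty, bot_eq_zero', NNReal.coe_zero]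
            positivity
          · left
            obtain ⟨i, hi, hx⟩ := Finset.exists_mem_eq_sup S hS x
            rw [hx]
            exact (le_max_left _ _).trans (Finset.single_le_sum
              (f := fun i => max ((x i : ℝ) - L * u) 0) (fun _ _ => le_max_right _ _) hi)
        have h₃ : 0 ≤ ∑ i ∈ S, max ((x i : ℝ) - L * u) 0 :=
          Finset.sum_nonneg fun _ _ => le_max_right _ _
        show ((S.sup x : ℝ≥0) : ℝ) ≤ _
        rcases le_total ((S.sup x : ℝ≥0) : ℝ) (L * u) with h | h
        · rw [min_eq_left h] at h₁
          linarith
        · rw [min_eq_right h] at h₁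
          rcases h₂ with h₂ | h₂ <;> linarith
    _ = surrogate μ u L S + u := by
        rw [integral_add (by exact hi₁.add hi₂) (integrable_const u), integral_add hi₁ hi₂,
          integral_finsetSum _ fun j _ => (hstep j).1,
          integral_finsetSum _ fun i _ => integrable_excess hC i _]
        simp only [(hstep _).2, integral_excess, surrogate]
        simp

theorem measure_sup_le {B : ℝ} (hB : 0 ≤ B) :
    (Measure.pi μ).real {x | ((S.sup x : ℝ≥0) : ℝ) ≤ B} =
      ∏ i ∈ S, (μ i).real {y | (y : ℝ) ≤ B} := by
  classical
  lift B to ℝ≥0 using hB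
  have : {x : ι → ℝ≥0 | ((S.sup x : ℝ≥0) : ℝ) ≤ B} =
      Set.pi Set.univ fun i => if i ∈ S then {y : ℝ≥0 | (y : ℝ) ≤ B} else Set.univ := by
    ext x
    simp only [NNReal.coe_le_coe, Set.mem_ofPred_eq, Finset.sup_le_iff, Set.mem_pi, Set.mem_univ,
      true_implies]
    refine forall_congr' fun i => ?_
    split_ifs with h <;> simp [h]
  rw [this, measureReal_def, Measure.pi_pi, ENNReal.toReal_prod,
    ← Finset.prod_subset (Finset.subset_univ S)]
  · refine Finset.prod_congr rfl fun i hi => ?_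
    simp [hi, measureReal_def]
  · intro i _ hi
    simp [hi]

omit [Fintype ι] in
/-- When exactly one coordinate exceeds `B`, the excess of the maximum is that coordinate's. -/
theorem sum_excess_mul_prod_le [DecidableEq ι] (x : ι → ℝ≥0) (B : ℝ) :
    ∑ i ∈ S, max ((x i : ℝ) - B) 0 * ∏ j ∈ S.erase i, (if (x j : ℝ) ≤ B then 1 else 0) ≤
      max (((S.sup x : ℝ≥0) : ℝ) - B) 0 := by
  by_cases h : ∃ i ∈ S, B < x i
  · obtain ⟨i, hi, hx⟩ := h
    rw [Finset.sum_eq_single_of_mem i hi]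
    · have h₁ : (x i : ℝ) ≤ ((S.sup x : ℝ≥0) : ℝ) := by exact_mod_cast Finset.le_sup hi
      have h₂ : ∏ j ∈ S.erase i, (if (x j : ℝ) ≤ B then (1 : ℝ) else 0) ≤ 1 :=
        Finset.prod_le_one (fun j _ => by split_ifs <;> norm_num)
          fun j _ => by split_ifs <;> norm_num
      exact (mul_le_of_le_one_right (le_max_right _ _) h₂).trans
        (max_le_max_right _ (by linarith))
    · intro j hj hji
      rw [Finset.prod_eq_zero (i := i) (Finset.mem_erase.2 ⟨hji.symm, hi⟩) (if_neg (by linarith)),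
        mul_zero]
  · push Not at h
    rw [Finset.sum_eq_zero]
    · exact le_max_right _ _
    · intro i hi
      rw [max_eq_right (by linarith [h i hi]), zero_mul]

theorem measurable_indicator_le (B : ℝ) :
    Measurable fun y : ℝ≥0 => if (y : ℝ) ≤ B then (1 : ℝ) else 0 :=
  Measurable.ite (measurableSet_le NNReal.continuous_coe.measurable measurable_const)
    measurable_const measurable_const

/-- By independence; the integrand is written as a product over all coordinates. -/
theorem integral_excess_mul_prod [DecidableEq ι] {i : ι} (hi : i ∈ S) (B : ℝ) :
    ∫ x : ι → ℝ≥0, max ((x i : ℝ) - B) 0 * ∏ j ∈ S.erase i, (if (x j : ℝ) ≤ B then 1 else 0)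
      ∂Measure.pi μ = excess (μ i) B * ∏ j ∈ S.erase i, (μ j).real {y | (y : ℝ) ≤ B} := by
  set f : ι → ℝ≥0 → ℝ := fun k y => if k = i then max ((y : ℝ) - B) 0 else
    if k ∈ S then (if (y : ℝ) ≤ B then 1 else 0) else 1 with hf
  have hS : ∀ g : ι → ℝ, (∀ k, k ∉ S → g k = 1) → ∏ k, g k = g i * ∏ k ∈ S.erase i, g k := by
    intro g hg
    rw [Finset.mul_prod_erase S g hi]
    exact (Finset.prod_subset (Finset.subset_univ S) fun k _ hk => hg k hk).symm
  have hne : ∀ k, k ∉ S → k ≠ i := fun k hk h => hk (h ▸ hi)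
  have h₁ : ∀ x : ι → ℝ≥0, max ((x i : ℝ) - B) 0 *
      ∏ j ∈ S.erase i, (if (x j : ℝ) ≤ B then 1 else 0) = ∏ k, f k (x k) := by
    intro x
    rw [hS _ fun k hk => by simp [hf, hne k hk, hk]]
    congr 1
    · simp [hf]
    · refine Finset.prod_congr rfl fun j hj => ?_
      obtain ⟨hji, hj⟩ := Finset.mem_erase.1 hj
      simp [hf, hji, hj]
  simp only [h₁]
  rw [integral_fintype_prod_eq_prod, hS]
  · congr 1
    · simp [hf, excess]
    · refine Finset.prod_congr rfl fun j hj => ?_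
      obtain ⟨hji, hj⟩ := Finset.mem_erase.1 hj
      have hm : MeasurableSet {y : ℝ≥0 | (y : ℝ) ≤ B} :=
        measurableSet_le NNReal.continuous_coe.measurable measurable_const
      have := integral_indicator_const (μ := μ j) (1 : ℝ) hm
      rw [smul_eq_mul, mul_one] at this
      rw [← this]
      refine integral_congr_ae (Filter.Eventually.of_forall fun y => ?_)
      simp [hf, hji, hj, Set.indicator_apply]
  · intro k hk
    simp [hf, hne k hk, hk]

include hC in
/-- The excess of the maximum is almost the sum of the excesses, if the maximum is unlikely to
exceed `B`. -/
theorem prob_mul_sum_excess_le {B : ℝ} (hB : 0 ≤ B) :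
    (Measure.pi μ).real {x | ((S.sup x : ℝ≥0) : ℝ) ≤ B} * ∑ i ∈ S, excess (μ i) B ≤
      ∫ x : ι → ℝ≥0, max (((S.sup x : ℝ≥0) : ℝ) - B) 0 ∂Measure.pi μ := by
  classical
  have hint : ∀ i ∈ S, Integrable (fun x : ι → ℝ≥0 => max ((x i : ℝ) - B) 0 *
      ∏ j ∈ S.erase i, (if (x j : ℝ) ≤ B then 1 else 0)) (Measure.pi μ) := by
    intro i _
    refine (integrable_excess hC i B).mul_bdd (c := 1) ?_ ?_
    · exact (Finset.measurable_prod _ fun j _ =>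
        (measurable_indicator_le B).comp (measurable_pi_apply j)).aestronglyMeasurable
    · refine Filter.Eventually.of_forall fun x => ?_
      rw [Real.norm_eq_abs, abs_of_nonneg (Finset.prod_nonneg fun j _ => by split_ifs <;> norm_num)]
      exact Finset.prod_le_one (fun j _ => by split_ifs <;> norm_num)
          fun j _ => by split_ifs <;> norm_num
  have hint' : Integrable (fun x : ι → ℝ≥0 => max (((S.sup x : ℝ≥0) : ℝ) - B) 0)
      (Measure.pi μ) := ((integrable_sup hC S).sub (integrable_const B)).sup (integrable_const 0)
  refine le_trans ?_ (integral_mono (integrable_finsetSum _ hint) hint'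
    fun x => sum_excess_mul_prod_le S x B)
  rw [integral_finsetSum _ hint, Finset.mul_sum]
  refine Finset.sum_le_sum fun i hi => ?_
  rw [integral_excess_mul_prod S hi, measure_sup_le S hB, mul_comm, ← Finset.mul_prod_erase S _ hi]
  refine mul_le_mul_of_nonneg_left ?_ (excess_nonneg _ _)
  exact mul_le_of_le_one_left (Finset.prod_nonneg fun _ _ => measureReal_nonneg)
    measureReal_le_one

include hC in
/-- The layers below `L u` and the excess of the maximum over `L u` are disjoint parts of the
maximum. -/
theorem sum_layers_add_le {u : ℝ} (hu : 0 < u) (L : ℕ) :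
    ∑ j ∈ Finset.range L, u * (1 - ∏ i ∈ S, (μ i).real {y | (y : ℝ) < (j + 1) * u}) +
      ∫ x : ι → ℝ≥0, max (((S.sup x : ℝ≥0) : ℝ) - L * u) 0 ∂Measure.pi μ ≤
    ∫ x : ι → ℝ≥0, ((S.sup x : ℝ≥0) : ℝ) ∂Measure.pi μ := by
  have hstep := fun j : ℕ => integral_step (μ := μ) S u (t := (j + 1) * u) (by positivity)
  have hi₁ : Integrable (fun x : ι → ℝ≥0 => ∑ j ∈ Finset.range L,
      if (j + 1) * u ≤ ((S.sup x : ℝ≥0) : ℝ) then u else 0) (Measure.pi μ) :=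
    integrable_finsetSum _ fun j _ => (hstep j).1
  have hi₂ : Integrable (fun x : ι → ℝ≥0 => max (((S.sup x : ℝ≥0) : ℝ) - L * u) 0)
      (Measure.pi μ) :=
    ((integrable_sup hC S).sub (integrable_const _)).sup (integrable_const 0)
  simp only [← (hstep _).2]
  rw [← integral_finsetSum _ fun j _ => (hstep j).1, ← integral_add hi₁ hi₂]
  refine integral_mono (hi₁.add hi₂) (integrable_sup hC S) fun x => ?_
  have h₁ := sum_steps_le u ((S.sup x : ℝ≥0) : ℝ) (by positivity) L
  show _ + max _ _ ≤ _
  rcases le_total ((S.sup x : ℝ≥0) : ℝ) (L * u) with h | h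
  · rw [min_eq_left h] at h₁
    rw [max_eq_right (by linarith)]
    linarith
  · rw [min_eq_right h] at h₁
    rw [max_eq_left (by linarith)]
    linarith

include hC in
/-- The surrogate is accurate for sets whose expected maximum is far below `L u`: by Markov's
inequality the maximum then rarely exceeds `L u`. -/
theorem surrogate_le {u : ℝ} (hu : 0 < u) {L : ℕ} (hL : 0 < L)
    (h : ∫ x : ι → ℝ≥0, ((S.sup x : ℝ≥0) : ℝ) ∂Measure.pi μ ≤ L * u / 2) :
    surrogate μ u L S ≤ ∫ x : ι → ℝ≥0, ((S.sup x : ℝ≥0) : ℝ) ∂Measure.pi μ +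
      2 * (∫ x : ι → ℝ≥0, ((S.sup x : ℝ≥0) : ℝ) ∂Measure.pi μ) ^ 2 / (L * u) := by
  have hB : (0 : ℝ) < L * u := by positivity
  have h₁ := sum_layers_add_le hC S hu L
  have h₂ := prob_mul_sum_excess_le hC S hB.le
  have h₃ := mul_meas_ge_le_integral_of_nonneg (μ := Measure.pi μ)
    (f := fun x : ι → ℝ≥0 => ((S.sup x : ℝ≥0) : ℝ))
    (Filter.Eventually.of_forall fun _ => NNReal.coe_nonneg _) (integrable_sup hC S) (L * u)
  have h₄ : 1 - (Measure.pi μ).real {x : ι → ℝ≥0 | L * u ≤ ((S.sup x : ℝ≥0) : ℝ)} ≤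
      (Measure.pi μ).real {x | ((S.sup x : ℝ≥0) : ℝ) ≤ L * u} := by
    rw [← probReal_compl_eq_one_sub
      (measurableSet_le measurable_const (measurable_sup S).coe_nnreal_real)]
    refine measureReal_mono fun x hx => ?_
    simp only [Set.mem_compl_iff, Set.mem_ofPred_eq, not_le] at hx
    exact hx.le
  have h₅ : 0 ≤ ∑ j ∈ Finset.range L,
      u * (1 - ∏ i ∈ S, (μ i).real {y | (y : ℝ) < (j + 1) * u}) :=
    Finset.sum_nonneg fun j _ => mul_nonneg hu.le (sub_nonneg.2
      (Finset.prod_le_one (fun _ _ => measureReal_nonneg) fun _ _ => measureReal_le_one))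
  have h₆ : 0 ≤ ∑ i ∈ S, excess (μ i) (L * u) := Finset.sum_nonneg fun i _ => excess_nonneg _ _
  unfold surrogate
  set r := ∫ x : ι → ℝ≥0, ((S.sup x : ℝ≥0) : ℝ) ∂Measure.pi μ
  set t := ∑ i ∈ S, excess (μ i) (L * u)
  set ρ := (Measure.pi μ).real {x : ι → ℝ≥0 | L * u ≤ ((S.sup x : ℝ≥0) : ℝ)}
  have h₇ : (1 - ρ) * t ≤ ∫ x : ι → ℝ≥0, max (((S.sup x : ℝ≥0) : ℝ) - L * u) 0 ∂Measure.pi μ :=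
    (mul_le_mul_of_nonneg_right h₄ h₆).trans h₂
  have hρ : ρ ≤ r / (L * u) := by
    rw [le_div_iff₀ hB]
    linarith
  have hρ' : ρ ≤ 1 / 2 := hρ.trans (by rw [div_le_iff₀ hB]; linarith)
  have ht : t ≤ 2 * r := by nlinarith
  have hr : 0 ≤ r := by linarith
  have : ρ * t ≤ r / (L * u) * (2 * r) := mul_le_mul hρ ht h₆ (by positivity)
  have e : 2 * r ^ 2 / (L * u) = r / (L * u) * (2 * r) := by ring
  rw [e]
  linarith

include hC in
theorem integral_sup_mono {S T : Finset ι} (h : S ⊆ T) :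
    ∫ x : ι → ℝ≥0, ((S.sup x : ℝ≥0) : ℝ) ∂Measure.pi μ ≤
      ∫ x : ι → ℝ≥0, ((T.sup x : ℝ≥0) : ℝ) ∂Measure.pi μ :=
  integral_mono (integrable_sup hC S) (integrable_sup hC T) fun _ =>
    NNReal.coe_le_coe.2 (Finset.sup_mono h)

include hC in
theorem excess_zero_le {i : ι} (hi : i ∈ S) :
    excess (μ i) 0 ≤ ∫ x : ι → ℝ≥0, ((S.sup x : ℝ≥0) : ℝ) ∂Measure.pi μ := by
  rw [← integral_excess]
  refine integral_mono (integrable_excess hC i 0) (integrable_sup hC S) fun x => ?_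
  simpa using Finset.le_sup (f := x) hi

include hC in
theorem integral_sup_le_sum_excess :
    ∫ x : ι → ℝ≥0, ((S.sup x : ℝ≥0) : ℝ) ∂Measure.pi μ ≤ ∑ i ∈ S, excess (μ i) 0 := by
  simp only [← integral_excess]
  rw [← integral_finsetSum _ fun i _ => integrable_excess hC i 0]
  refine integral_mono (integrable_sup hC S)
    (integrable_finsetSum _ fun i _ => integrable_excess hC i 0) fun x => ?_
  simp only [sub_zero, NNReal.coe_nonneg, max_eq_left]
  rw [← NNReal.coe_sum, NNReal.coe_le_coe]
  exact Finset.sup_le fun i hi => Finset.single_le_sum (f := x) (fun _ _ => zero_le) hi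

include hC in
theorem integral_sup_le_bound :
    ∫ x : ι → ℝ≥0, ((S.sup x : ℝ≥0) : ℝ) ∂Measure.pi μ ≤ C := by
  have : ∫ _ : ι → ℝ≥0, (C : ℝ) ∂Measure.pi μ = C := by simp
  rw [← this]
  refine integral_mono_ae (integrable_sup hC S) (integrable_const _) ?_
  filter_upwards [ae_le hC] with x hx
  exact NNReal.coe_le_coe.2 (Finset.sup_le fun i _ => hx i)

end ExpMax

/-! ### The estimate computed from the table -/

namespace KnapsackTable

/-- The estimate read off a table entry: the digits of the state `z` give the layers of height `u`,
and `g` is one more than the total of the scaled mean excesses. -/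
def value (b L D u z g : ℕ) : ℕ :=
  ∑ j ∈ Finset.range L, (b - 1 - digit b j z) * (u * D) + (b - 1) * g

/-- The estimate for the arms in `S`, given the scaled distribution functions `q` and mean
excesses `T` of the arms `0, …, m - 1`. -/
def estimate (m b L D u : ℕ) (q : ℕ → ℕ → ℕ) (T : ℕ → ℕ) (S : Finset ℕ) : ℕ :=
  value b L D u (reach (fun i => shift b L D (q i)) (b ^ L - 1) S m) (1 + ∑ i ∈ S, T i)

end KnapsackTable

namespace ExpMax

open KnapsackTable

section

variable {m : ℕ} {μ : Fin m → Measure ℝ≥0} [∀ i, IsProbabilityMeasure (μ i)] {C : ℝ≥0}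
  (hC : ∀ i, ∀ᵐ y ∂μ i, y ≤ C) {b L D u : ℕ} {q : ℕ → ℕ → ℕ} {T : ℕ → ℕ} {c : ℝ} (hc : 0 < c)
  (hD : 0 < D)

/-- The numbers `q i j` and `T i` describe the distributions `μ i` exactly: `q i` is the distribution
function in units of `1 / D`, and `T i` the mean excess over `L * u` in units of `1 / (D * c)`, where
lengths are measured in units of `1 / c`. -/
structure Describes (μ : Fin m → Measure ℝ≥0) (L D u : ℕ) (c : ℝ) (q : ℕ → ℕ → ℕ) (T : ℕ → ℕ) :
    Prop where
  le : ∀ i < m, ∀ j < L, q i j ≤ D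
  cdf : ∀ (i : Fin m) (j : ℕ), j < L →
    (q i j / D : ℝ) = (μ i).real {y | (y : ℝ) < (j + 1) * (u / c)}
  excess : ∀ i : Fin m, (T i : ℝ) / (D * c) = excess (μ i) (L * (u / c))

omit [∀ i, IsProbabilityMeasure (μ i)] in
include hc hD in
/-- Up to scaling, the estimate exceeds the surrogate by at most one unit: each of the `L` digits has
lost at most `m` of its `b - 1 > L * m` parts to rounding. -/
theorem estimate_bounds (hb : L * m + 1 < b) (h : Describes μ L D u c q T) (S : Finset (Fin m)) :
    (b - 1 : ℕ) * D * c * surrogate μ (u / c) L S + (b - 1 : ℕ) ≤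
      estimate m b L D u q T (S.map Fin.valEmbedding) ∧
    (estimate m b L D u q T (S.map Fin.valEmbedding) : ℝ) ≤
      (b - 1 : ℕ) * D * c * (surrogate μ (u / c) L S + u / c) + (b - 1 : ℕ) := by
  have hD' : (0 : ℝ) < D := by exact_mod_cast hD
  set z := reach (fun i => shift b L D (q i)) (b ^ L - 1) (S.map Fin.valEmbedding) m with hz
  set N := b - 1 with hN
  have hint : S.map Fin.valEmbedding ∩ Finset.range m = S.map Fin.valEmbedding := by
    rw [Finset.inter_eq_left]
    intro a
    simp only [Finset.mem_map, Fin.valEmbedding_apply, Finset.mem_range]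
    rintro ⟨i, _, rfl⟩
    exact i.2
  have hdig := fun j (hj : j < L) =>
    digit_reach (b := b) (by omega) (S := S.map Fin.valEmbedding) h.le hj
  simp only [hint, Finset.card_map, Finset.prod_map, Fin.valEmbedding_apply, ← hz, ← hN] at hdig
  have hcard : (S.card : ℝ) ≤ m := by exact_mod_cast card_finset_fin_le S
  have hLm : (L * m : ℝ) ≤ N := by
    have : L * m ≤ N := by omega
    exact_mod_cast this
  have hT : (∑ i ∈ S, (T i : ℝ)) = D * c * ∑ i ∈ S, ExpMax.excess (μ i) (L * (u / c)) := by
    rw [Finset.mul_sum]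
    refine Finset.sum_congr rfl fun i _ => ?_
    rw [← h.excess i]
    field_simp
  have hest : (estimate m b L D u q T (S.map Fin.valEmbedding) : ℝ) =
      ∑ j ∈ Finset.range L, ((N : ℝ) - digit b j z) * (u * D) +
        N * (1 + D * c * ∑ i ∈ S, ExpMax.excess (μ i) (L * (u / c))) := by
    rw [← hT]
    simp only [estimate, value, ← hz, ← hN, Nat.cast_add, Nat.cast_sum, Nat.cast_mul, Nat.cast_one,
      Finset.sum_map, Fin.valEmbedding_apply]
    congr 1
    refine Finset.sum_congr rfl fun j _ => ?_
    rw [Nat.cast_sub]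
    exact Nat.le_sub_one_of_lt (Nat.mod_lt _ (by omega))
  have hsur : (N : ℝ) * D * c * surrogate μ (u / c) L S =
      ∑ j ∈ Finset.range L, ((N : ℝ) - N * ∏ i ∈ S, (q i j / D : ℝ)) * (u * D) +
        N * (D * c * ∑ i ∈ S, ExpMax.excess (μ i) (L * (u / c))) := by
    unfold surrogate
    rw [mul_add, Finset.mul_sum]
    congr 1
    · refine Finset.sum_congr rfl fun j hj => ?_
      rw [Finset.prod_congr rfl fun i _ => (h.cdf i j (Finset.mem_range.1 hj)).symm]
      field_simp
    · ring
  have h₁ : ∑ j ∈ Finset.range L, ((N : ℝ) - N * ∏ i ∈ S, (q i j / D : ℝ)) * (u * D) ≤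
      ∑ j ∈ Finset.range L, ((N : ℝ) - digit b j z) * (u * D) :=
    Finset.sum_le_sum fun j hj => mul_le_mul_of_nonneg_right
      (by linarith [(hdig j (Finset.mem_range.1 hj)).1]) (by positivity)
  have h₂ : ∑ j ∈ Finset.range L, ((N : ℝ) - digit b j z) * (u * D) ≤
      ∑ j ∈ Finset.range L, ((N : ℝ) - N * ∏ i ∈ S, (q i j / D : ℝ)) * (u * D) +
        L * m * (u * D) := by
    have : (L * m * (u * D) : ℝ) = ∑ j ∈ Finset.range L, (m : ℝ) * (u * D) := by
      simp [mul_assoc]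
    rw [this, ← Finset.sum_add_distrib]
    refine Finset.sum_le_sum fun j hj => ?_
    rw [← add_mul]
    exact mul_le_mul_of_nonneg_right
      (by linarith [(hdig j (Finset.mem_range.1 hj)).2]) (by positivity)
  have h₃ : (L * m * (u * D) : ℝ) ≤ N * (u * D) := mul_le_mul_of_nonneg_right hLm (by positivity)
  have h₄ : (N : ℝ) * D * c * (u / c) = N * (u * D) := by field_simp
  rw [mul_add, h₄, hest, hsur]
  constructor <;> linarith

/-- The test that decides whether the unit `u` is large enough: up to scaling, the estimate is at most
`3 * e * u`. There are `L = e * e` layers, which reach up to `e * (e * u)`. -/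
def Passes (m b e D u : ℕ) (q : ℕ → ℕ → ℕ) (T : ℕ → ℕ) (S : Finset ℕ) : Prop :=
  estimate m b (e * e) D u q T S ≤ 3 * e * u * (b - 1) * D + (b - 1)

variable {e : ℕ} (he : 12 ≤ e)

include hC hc hD he in
/-- A set that fails the test for `u` has expected maximum above `e * u`, as otherwise its surrogate
would be accurate. -/
theorem lt_of_not_passes (hu : 0 < u) (hb : e * e * m + 1 < b)
    (h : Describes μ (e * e) D u c q T) (S : Finset (Fin m))
    (hS : ¬ Passes m b e D u q T (S.map Fin.valEmbedding)) :
    e * u / c < ∫ x, ((S.sup x : ℝ≥0) : ℝ) ∂Measure.pi μ := by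
  by_contra! hr
  have he' : (12 : ℝ) ≤ e := by exact_mod_cast he
  have hN : (0 : ℝ) < (b - 1 : ℕ) := by exact_mod_cast (by omega : 0 < b - 1)
  have hD' : (0 : ℝ) < D := by exact_mod_cast hD
  have hu' : (0 : ℝ) < u / c := div_pos (by exact_mod_cast hu) hc
  have hr0 : 0 ≤ ∫ x, ((S.sup x : ℝ≥0) : ℝ) ∂Measure.pi μ :=
    integral_nonneg fun _ => NNReal.coe_nonneg _
  have hest := (estimate_bounds hc hD hb h S).2
  have hpass : (3 * e * u * (b - 1 : ℕ) * D + (b - 1 : ℕ) : ℝ) <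
      estimate m b (e * e) D u q T (S.map Fin.valEmbedding) := by
    unfold Passes at hS
    exact_mod_cast not_le.1 hS
  rw [mul_div_assoc] at hr
  have hsur := surrogate_le hC S hu' (L := e * e) (by positivity) (by push_cast; nlinarith)
  set r := ∫ x, ((S.sup x : ℝ≥0) : ℝ) ∂Measure.pi μ
  set v := (u / c : ℝ) with hv
  have huv : (u : ℝ) = c * v := by rw [hv]; field_simp
  have h₁ : 2 * r ^ 2 / ((e * e : ℕ) * v) ≤ 2 * v := by
    push_cast
    rw [div_le_iff₀ (by positivity)]
    nlinarith [mul_le_mul hr hr hr0 (by positivity)]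
  have h₂ : (3 * e * u * (b - 1 : ℕ) * D : ℝ) < (b - 1 : ℕ) * D * c * (e * v + 2 * v + v) := by
    have : (b - 1 : ℕ) * D * c * (surrogate μ v (e * e) S + v) ≤
        (b - 1 : ℕ) * D * c * (e * v + 2 * v + v) :=
      mul_le_mul_of_nonneg_left (by linarith) (by positivity)
    linarith
  have h₃ : (3 * e * u * (b - 1 : ℕ) * D : ℝ) = (b - 1 : ℕ) * D * c * (3 * e * v) := by
    rw [huv]; ring
  rw [h₃] at h₂
  have := lt_of_mul_lt_mul_left h₂ (by positivity)
  nlinarith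

include hC hc hD he in
/-- A set of maximal estimate that passes the test is as good as any other set, up to a relative
error of `8 / e` and an absolute error of two layers. -/
theorem le_of_passes (hu : 0 < u) (hb : e * e * m + 1 < b)
    (h : Describes μ (e * e) D u c q T) (S S' : Finset (Fin m))
    (hS : Passes m b e D u q T (S.map Fin.valEmbedding))
    (hS' : estimate m b (e * e) D u q T (S'.map Fin.valEmbedding) ≤
      estimate m b (e * e) D u q T (S.map Fin.valEmbedding)) :
    ∫ x, ((S'.sup x : ℝ≥0) : ℝ) ∂Measure.pi μ ≤
      (1 + 8 / e) * ∫ x, ((S.sup x : ℝ≥0) : ℝ) ∂Measure.pi μ + 2 * (u / c) := by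
  have he' : (12 : ℝ) ≤ e := by exact_mod_cast he
  have hN : (0 : ℝ) < (b - 1 : ℕ) := by exact_mod_cast (by omega : 0 < b - 1)
  have hD' : (0 : ℝ) < D := by exact_mod_cast hD
  have hu' : (0 : ℝ) < u / c := div_pos (by exact_mod_cast hu) hc
  have hpos : 0 < (b - 1 : ℕ) * D * c := by positivity
  have hpass : (estimate m b (e * e) D u q T (S.map Fin.valEmbedding) : ℝ) ≤
      3 * e * u * (b - 1 : ℕ) * D + (b - 1 : ℕ) := by
    unfold Passes at hS
    exact_mod_cast hS
  have hS'' : (estimate m b (e * e) D u q T (S'.map Fin.valEmbedding) : ℝ) ≤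
      estimate m b (e * e) D u q T (S.map Fin.valEmbedding) := by exact_mod_cast hS'
  have hr0 : ∀ S : Finset (Fin m), 0 ≤ ∫ x, ((S.sup x : ℝ≥0) : ℝ) ∂Measure.pi μ :=
    fun S => integral_nonneg fun _ => NNReal.coe_nonneg _
  have hmain : ∀ S₁ : Finset (Fin m), (estimate m b (e * e) D u q T (S₁.map Fin.valEmbedding) : ℝ) ≤
      estimate m b (e * e) D u q T (S.map Fin.valEmbedding) →
      ∫ x, ((S₁.sup x : ℝ≥0) : ℝ) ∂Measure.pi μ ≤
        surrogate μ (u / c) (e * e) S + 2 * (u / c) ∧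
      ∫ x, ((S₁.sup x : ℝ≥0) : ℝ) ∂Measure.pi μ ≤ 4 * e * (u / c) := by
    intro S₁ h₁
    have h₂ := (estimate_bounds hc hD hb h S₁).1
    have h₃ := (estimate_bounds hc hD hb h S).2
    have h₄ := integral_sup_le hC S₁ hu' (e * e)
    have h₅ : surrogate μ (u / c) (e * e) S₁ ≤ surrogate μ (u / c) (e * e) S + u / c :=
      le_of_mul_le_mul_left (by linarith) hpos
    have h₆ : (3 * e * u * (b - 1 : ℕ) * D : ℝ) = (b - 1 : ℕ) * D * c * (3 * e * (u / c)) := by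
      field_simp
    have h₇ : surrogate μ (u / c) (e * e) S₁ ≤ 3 * e * (u / c) :=
      le_of_mul_le_mul_left (by linarith) hpos
    exact ⟨by linarith, by nlinarith⟩
  have h₁ := (hmain S' hS'').1
  have h₂ := (hmain S le_rfl).2
  have hsur := surrogate_le hC S hu' (L := e * e) (by positivity) (by
    have : 0 ≤ (e : ℝ) * (u / c) * (e - 12) :=
      mul_nonneg (by positivity) (by linarith)
    push_cast
    nlinarith)
  set r := ∫ x, ((S.sup x : ℝ≥0) : ℝ) ∂Measure.pi μ
  have h₃ : 2 * r ^ 2 / ((e * e : ℕ) * (u / c)) ≤ 8 / e * r := by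
    rw [div_le_iff₀ (by push_cast; positivity)]
    have e₁ : 8 / e * r * ((e * e : ℕ) * (u / c)) = 2 * r * (4 * e * (u / c)) := by
      push_cast
      field_simp
      ring
    rw [e₁]
    nlinarith [hr0 S]
  linarith

include hC hc hD he in
/-- A set of maximal estimate that passes the test is nearly optimal, if the unit cannot be halved:
the unit is the smallest one, at most an `e`-th of any positive mean, or half of it failed. -/
theorem approx_of_passes (hu : 0 < u) (hb : e * e * m + 1 < b) {K : ℕ}
    (h : Describes μ (e * e) D u c q T) (S : Finset (Fin m))
    (hS : Passes m b e D u q T (S.map Fin.valEmbedding)) (hcard : S.card = min K m)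
    (hmax : ∀ S' : Finset (Fin m), S'.card = min K m →
      estimate m b (e * e) D u q T (S'.map Fin.valEmbedding) ≤
        estimate m b (e * e) D u q T (S.map Fin.valEmbedding))
    (hmin : (u = 1 ∧ ∀ i, ExpMax.excess (μ i) 0 = 0 ∨ e / c ≤ ExpMax.excess (μ i) 0) ∨
      ∃ S' : Finset (Fin m), S'.card = min K m ∧
        e * u / (2 * c) < ∫ x, ((S'.sup x : ℝ≥0) : ℝ) ∂Measure.pi μ)
    (S' : Finset (Fin m)) (hS' : S'.card ≤ K) :
    (1 - 12 / e) * ∫ x, ((S'.sup x : ℝ≥0) : ℝ) ∂Measure.pi μ ≤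
      ∫ x, ((S.sup x : ℝ≥0) : ℝ) ∂Measure.pi μ := by
  have he' : (12 : ℝ) ≤ e := by exact_mod_cast he
  have hr0 : ∀ S : Finset (Fin m), 0 ≤ ∫ x, ((S.sup x : ℝ≥0) : ℝ) ∂Measure.pi μ :=
    fun S => integral_nonneg fun _ => NNReal.coe_nonneg _
  have hext : ∀ S₁ : Finset (Fin m), S₁.card ≤ K → ∃ S₂, S₁ ⊆ S₂ ∧ S₂.card = min K m := by
    intro S₁ h₁
    obtain ⟨S₂, h₂, _, h₃⟩ := Finset.exists_subsuperset_card_eq (Finset.subset_univ S₁)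
      (n := min K m) (le_min h₁ (card_finset_fin_le S₁)) (by simp)
    exact ⟨S₂, h₂, h₃⟩
  -- An optimal set of full size; by monotonicity it is optimal among all sets of size at most `K`.
  have hne : (Finset.univ.filter fun S₁ : Finset (Fin m) => S₁.card = min K m).Nonempty :=
    ⟨S, by simpa using hcard⟩
  obtain ⟨S₀, hS₀, hopt⟩ := Finset.exists_max_image _
    (fun S₁ : Finset (Fin m) => ∫ x, ((S₁.sup x : ℝ≥0) : ℝ) ∂Measure.pi μ) hne
  simp only [Finset.mem_filter, Finset.mem_univ, true_and] at hS₀ hopt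
  have hopt' : ∀ S₁ : Finset (Fin m), S₁.card ≤ K → ∫ x, ((S₁.sup x : ℝ≥0) : ℝ) ∂Measure.pi μ ≤
      ∫ x, ((S₀.sup x : ℝ≥0) : ℝ) ∂Measure.pi μ := by
    intro S₁ h₁
    obtain ⟨S₂, h₂, h₃⟩ := hext S₁ h₁
    exact (integral_sup_mono hC h₂).trans (hopt S₂ h₃)
  have hlow : ∫ x, ((S₀.sup x : ℝ≥0) : ℝ) ∂Measure.pi μ ≤ 0 ∨
      e * (u / c) ≤ 2 * ∫ x, ((S₀.sup x : ℝ≥0) : ℝ) ∂Measure.pi μ := by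
    rcases hmin with ⟨rfl, hi⟩ | ⟨S₁, h₁, h₂⟩
    · by_cases h0 : ∀ i ∈ S₀, ExpMax.excess (μ i) 0 = 0
      · left
        exact (integral_sup_le_sum_excess hC S₀).trans_eq (Finset.sum_eq_zero h0)
      · right
        push Not at h0
        obtain ⟨i, hi₀, hi₁⟩ := h0
        have h₁ := (hi i).resolve_left hi₁
        have h₂ := excess_zero_le hC S₀ hi₀
        have : (e * ((1 : ℕ) / c) : ℝ) = e / c := by push_cast; ring
        rw [this]
        linarith [hr0 S₀]
    · right
      have := hopt S₁ h₁
      have e₁ : (e * u / (2 * c) : ℝ) = e * (u / c) / 2 := by field_simp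
      rw [e₁] at h₂
      linarith
  have h₁ := le_of_passes hC hc hD he hu hb h S S₀ hS (hmax S₀ hS₀)
  have h₂ := hopt' S' hS'
  have h₃ := hopt S hcard
  set r := ∫ x, ((S.sup x : ℝ≥0) : ℝ) ∂Measure.pi μ
  set r₀ := ∫ x, ((S₀.sup x : ℝ≥0) : ℝ) ∂Measure.pi μ
  have h12 : (12 / e : ℝ) ≤ 1 := by
    rw [div_le_one (by positivity)]
    exact he'
  refine (mul_le_mul_of_nonneg_left h₂ (by linarith)).trans ?_
  rcases hlow with h0 | hW
  · exact (mul_nonpos_of_nonneg_of_nonpos (by linarith) h0).trans (hr0 S)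
  · have h₄ : u / c ≤ 2 / e * r₀ := by
      rw [div_mul_eq_mul_div, le_div_iff₀ (by positivity), mul_comm]
      exact hW
    have h₅ : 8 / e * r ≤ 8 / e * r₀ := mul_le_mul_of_nonneg_left h₃ (by positivity)
    have e₁ : (12 / e : ℝ) * r₀ = 8 / e * r₀ + 2 * (2 / e * r₀) := by ring
    nlinarith

end

end ExpMax

/-! ### Instances in integers -/

namespace KMaxInstance

variable (I : KMaxInstance)

/-- A common denominator of all values and probabilities. -/
def denom : ℕ := ∏ i, ∏ j, (I.v i j).den * (I.p i j).den

/-- The probabilities in units of `1 / denom`. -/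
def mass (i : Fin I.m) (j : Fin (I.s i)) : ℕ := (I.p i j).num * (I.denom / (I.p i j).den)

/-- The values in units of `1 / (denom ^ 2 * e)`. A positive mean is at least `1 / denom ^ 2`, which
makes `e` units. -/
def scaled (e : ℕ) (i : Fin I.m) (j : Fin (I.s i)) : ℕ :=
  (I.v i j).num * (I.denom / (I.v i j).den) * I.denom * e

/-- The distribution function of arm `i` in units of `1 / denom`. -/
def cdf (e u : ℕ) (i : Fin I.m) (j : ℕ) : ℕ :=
  ∑ l, I.mass i l * if I.scaled e i l < (j + 1) * u then 1 else 0

/-- The mean excess of arm `i` over `L * u`, scaled. -/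
def tail (e L u : ℕ) (i : Fin I.m) : ℕ := ∑ l, I.mass i l * (I.scaled e i l - L * u)

theorem denom_pos : 0 < I.denom :=
  Finset.prod_pos fun _ _ => Finset.prod_pos fun _ _ => Nat.mul_pos (NNRat.den_pos _) (NNRat.den_pos _)

theorem den_dvd (i : Fin I.m) (j : Fin (I.s i)) : (I.v i j).den * (I.p i j).den ∣ I.denom :=
  (Finset.dvd_prod_of_mem (fun j => (I.v i j).den * (I.p i j).den) (Finset.mem_univ j)).trans
    (Finset.dvd_prod_of_mem (fun i => ∏ j, (I.v i j).den * (I.p i j).den) (Finset.mem_univ i))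

theorem cast_num_mul {r : ℚ≥0} {D : ℕ} (h : r.den ∣ D) :
    ((r.num * (D / r.den) : ℕ) : ℝ) = ((r : ℝ≥0) : ℝ) * D := by
  have : (r.den : ℝ) ≠ 0 := by exact_mod_cast r.den_ne_zero
  have e : ((r : ℝ≥0) : ℝ) = r.num / r.den := by
    rw [NNRat.cast_def]
    simp
  rw [Nat.cast_mul, Nat.cast_div h this, e]
  field_simp

theorem cast_mass (i : Fin I.m) (j : Fin (I.s i)) :
    (I.mass i j : ℝ) = ((I.p i j : ℝ≥0) : ℝ) * I.denom :=
  cast_num_mul ((Dvd.intro_left _ rfl).trans (I.den_dvd i j))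

theorem cast_scaled (e : ℕ) (i : Fin I.m) (j : Fin (I.s i)) :
    (I.scaled e i j : ℝ) = ((I.v i j : ℝ≥0) : ℝ) * (I.denom ^ 2 * e) := by
  have := cast_num_mul ((Dvd.intro _ rfl).trans (I.den_dvd i j))
  rw [scaled, Nat.cast_mul, Nat.cast_mul, this]
  ring

instance (i : Fin I.m) : IsProbabilityMeasure (I.law i) where
  measure_univ := by
    simp only [law, Measure.coe_finsetSum, Finset.sum_apply, Measure.smul_apply, measure_univ,
      smul_eq_mul, mul_one]
    have := congrArg (fun r : ℚ≥0 => ((r : ℝ≥0) : ℝ≥0∞)) (I.sum_p i)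
    push_cast at this
    exact this

theorem ae_law {P : ℝ≥0 → Prop} (i : Fin I.m) (h : ∀ j, P (I.v i j)) : ∀ᵐ y ∂I.law i, P y := by
  rw [law, ae_iff]
  simp [Measure.dirac_apply, h]

theorem integral_law (i : Fin I.m) (f : ℝ≥0 → ℝ) :
    ∫ y, f y ∂I.law i = ∑ j, ((I.p i j : ℝ≥0) : ℝ) * f (I.v i j) := by
  rw [law, integral_finsetSum_measure]
  · refine Finset.sum_congr rfl fun j _ => ?_
    rw [integral_smul_measure, integral_dirac]
    simp
  · intro j _
    exact (integrable_dirac (by finiteness)).smul_measure (by simp)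

theorem sum_mass (i : Fin I.m) : ∑ j, I.mass i j = I.denom := by
  have : (∑ j, (I.mass i j : ℝ)) = I.denom := by
    simp only [cast_mass]
    rw [← Finset.sum_mul]
    have := congrArg (fun r : ℚ≥0 => ((r : ℝ≥0) : ℝ)) (I.sum_p i)
    push_cast at this
    rw [this, one_mul]
  exact_mod_cast this

theorem cdf_le (e u : ℕ) (i : Fin I.m) (j : ℕ) : I.cdf e u i j ≤ I.denom := by
  rw [← I.sum_mass i]
  refine Finset.sum_le_sum fun l _ => ?_
  split_ifs <;> simp

theorem cast_cdf {e : ℕ} (he : 0 < e) (u : ℕ) (i : Fin I.m) (j : ℕ) :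
    (I.cdf e u i j / I.denom : ℝ) =
      (I.law i).real {y | (y : ℝ) < (j + 1) * (u / (I.denom ^ 2 * e))} := by
  have hD : (0 : ℝ) < I.denom := by exact_mod_cast I.denom_pos
  have he' : (0 : ℝ) < e := by exact_mod_cast he
  have hm : MeasurableSet {y : ℝ≥0 | (y : ℝ) < (j + 1) * (u / (I.denom ^ 2 * e))} :=
    measurableSet_lt NNReal.continuous_coe.measurable measurable_const
  have := integral_indicator_const (μ := I.law i) (1 : ℝ) hm
  rw [smul_eq_mul, mul_one] at this
  rw [← this, integral_law, cdf]
  push_cast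
  rw [Finset.sum_div]
  refine Finset.sum_congr rfl fun l _ => ?_
  have key : I.scaled e i l < (j + 1) * u ↔
      ((I.v i l : ℝ≥0) : ℝ) < (j + 1) * (u / (I.denom ^ 2 * e)) := by
    rw [← Nat.cast_lt (α := ℝ), cast_scaled, ← mul_div_assoc, lt_div_iff₀ (by positivity)]
    push_cast
    rfl
  rw [cast_mass, Set.indicator_apply]
  simp only [key, Set.mem_ofPred_eq]
  split_ifs <;> field_simp

theorem cast_tail {e : ℕ} (he : 0 < e) (L u : ℕ) (i : Fin I.m) :
    (I.tail e L u i : ℝ) / (I.denom * (I.denom ^ 2 * e)) =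
      ExpMax.excess (I.law i) (L * (u / (I.denom ^ 2 * e))) := by
  have hD : (0 : ℝ) < I.denom := by exact_mod_cast I.denom_pos
  have he' : (0 : ℝ) < e := by exact_mod_cast he
  rw [ExpMax.excess, integral_law, tail, Nat.cast_sum, Finset.sum_div]
  refine Finset.sum_congr rfl fun l _ => ?_
  have : ((I.scaled e i l - L * u : ℕ) : ℝ) = (I.denom ^ 2 * e) *
      max (((I.v i l : ℝ≥0) : ℝ) - L * (u / (I.denom ^ 2 * e))) 0 := by
    rw [mul_max_of_nonneg _ _ (by positivity), mul_sub, mul_zero]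
    have h₁ : (I.denom ^ 2 * e : ℝ) * (L * (u / (I.denom ^ 2 * e))) = (L * u : ℕ) := by
      push_cast
      field_simp
    rw [h₁, mul_comm (I.denom ^ 2 * e : ℝ), ← cast_scaled]
    rcases le_total (L * u) (I.scaled e i l) with h | h
    · rw [Nat.cast_sub h, max_eq_left]
      exact sub_nonneg.2 (Nat.cast_le.2 h)
    · rw [Nat.sub_eq_zero_of_le h, max_eq_right, Nat.cast_zero]
      exact sub_nonpos.2 (Nat.cast_le.2 h)
  rw [Nat.cast_mul, this, cast_mass]
  field_simp

theorem describes {e : ℕ} (he : 0 < e) {L u : ℕ} {q : ℕ → ℕ → ℕ} {T : ℕ → ℕ}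
    (hq : ∀ (i : Fin I.m), ∀ j < L, q i j = I.cdf e u i j) (hT : ∀ i : Fin I.m, T i = I.tail e L u i) :
    ExpMax.Describes I.law L I.denom u (I.denom ^ 2 * e) q T where
  le i hi j hj := (hq ⟨i, hi⟩ j hj).trans_le (I.cdf_le e u _ j)
  cdf i j hj := by rw [hq i j hj, I.cast_cdf he]
  excess i := by rw [hT i, I.cast_tail he]

/-- A positive mean is at least `1 / denom ^ 2`, being a sum of multiples of it. -/
theorem excess_zero_or {e : ℕ} (he : 0 < e) (i : Fin I.m) :
    ExpMax.excess (I.law i) 0 = 0 ∨ (e : ℝ) / (I.denom ^ 2 * e) ≤ ExpMax.excess (I.law i) 0 := by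
  have hD : (0 : ℝ) < I.denom := by exact_mod_cast I.denom_pos
  have he' : (0 : ℝ) < e := by exact_mod_cast he
  have h := I.cast_tail he 0 0 i
  simp only [Nat.cast_zero, zero_mul] at h
  rw [← h]
  rcases Nat.eq_zero_or_pos (I.tail e 0 0 i) with h0 | h0
  · left
    simp [h0]
  · right
    have hdvd : I.denom * e ∣ I.tail e 0 0 i := by
      refine Finset.dvd_sum fun l _ => ?_
      rw [zero_mul, Nat.sub_zero, scaled, mul_assoc (_ * _) I.denom e]
      exact Dvd.dvd.mul_left (Dvd.intro_left _ rfl) _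
    have : (I.denom * e : ℝ) ≤ I.tail e 0 0 i := by exact_mod_cast Nat.le_of_dvd h0 hdvd
    rw [div_le_div_iff₀ (by positivity) (by positivity)]
    calc (e : ℝ) * (I.denom * (I.denom ^ 2 * e)) = (I.denom * e) * (I.denom ^ 2 * e) := by ring
      _ ≤ _ := mul_le_mul_of_nonneg_right this (by positivity)

end KMaxInstance

namespace RAM

@[simp] theorem State.write_same (σ : State) (a i v : ℕ) :
    (σ.write a i v) a = Function.update (σ a) i v := by
  funext i'
  simp [State.write, Function.update_apply]

@[simp] theorem State.write_of_ne {σ : State} {a a' : ℕ} (h : a' ≠ a) (i v : ℕ) :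
    (σ.write a i v) a' = σ a' := by
  funext i'
  simp [State.write, h]

theorem size_le_of_le {x B R : ℕ} (h : x ≤ B) (hB : B < 2 ^ R) : x.size ≤ R :=
  Nat.size_le.2 (h.trans_lt hB)

/-- The states agree outside the arrays in `X`. -/
def Agree (X : List ℕ) (σ τ : State) : Prop := ∀ a, a ∉ X → σ a = τ a

end RAM

/-! ### The program -/

namespace KMaxProgram

open RAM KnapsackTable

local infixr:60 " ;; " => Cmd.seq
local infix:62 " ≔ " => Cmd.assign
local prefix:max "⋆" => Expr.var

/-! Memory layout: array `0` is the input and array `1` the output. Of the other arrays, all but the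
table `mTab` and the distribution function `mCdf` of the current arm are used as variables, with cell
`0` only. -/

local notation "mDen" => 2
local notation "mPtr" => 3
local notation "mArm" => 4
local notation "mEnt" => 5
local notation "mTop" => 6
local notation "mBase" => 7
local notation "mFull" => 8
local notation "mCap" => 9
local notation "mUnit" => 10
local notation "mTail" => 11
local notation "mBit" => 12
local notation "mIdx" => 13
local notation "mTmp" => 14
local notation "mBest" => 15
local notation "mCode" => 16
local notation "mGo" => 17
local notation "mTab" => 18
local notation "mCdf" => 19

/-- Reads the input once to compute the common denominator and `2 ^ m`. -/
def readDenom : Cmd :=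
  mDen ≔ 1 ;; mTop ≔ 1 ;; mPtr ≔ 2 ;; mArm ≔ .get 0 0 ;;
  .countdown mArm
    (mEnt ≔ .get 0 ⋆mPtr ;; mPtr ≔ ⋆mPtr + 1 ;;
     .countdown mEnt
      (mDen ≔ ⋆mDen * (.get 0 (⋆mPtr + 1) * .get 0 (⋆mPtr + 3)) ;; mPtr ≔ ⋆mPtr + 4) ;;
     mTop ≔ ⋆mTop * 2)

/-- Sets the base `b` of the state encoding, the number `b ^ L` of states for each size, and the size
`min K m` of the sets to be found. -/
def setup (L : ℕ) : Cmd :=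
  mBase ≔ .const L * .get 0 0 + 2 ;;
  mFull ≔ .pow ⋆mBase L ;;
  mCap ≔ .get 0 1 - (.get 0 1 - .get 0 0) ;;
  mUnit ≔ 1 ;; mGo ≔ 1

/-- Empties the table and enters the empty set. -/
def clearTable : Cmd :=
  mIdx ≔ (⋆mCap + 1) * ⋆mFull ;;
  .countdown mIdx (.set mTab ⋆mIdx 0) ;;
  .set mTab (⋆mFull - 1) ⋆mTop

/-- The scaled probability of the entry at the pointer. -/
def massExpr : Expr := .get 0 (⋆mPtr + 2) * (⋆mDen / .get 0 (⋆mPtr + 3))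

/-- The scaled value of the entry at the pointer. -/
def valueExpr (e : ℕ) : Expr :=
  .get 0 ⋆mPtr * (⋆mDen / .get 0 (⋆mPtr + 1)) * ⋆mDen * .const e

/-- `1` if `x < y` and `0` otherwise. -/
def ltExpr (x y : Expr) : Expr := 1 - (1 - (y - x))

/-- Computes the distribution function and the mean excess of the arm at the pointer. -/
def readArm (e L : ℕ) : Cmd :=
  mEnt ≔ .get 0 ⋆mPtr ;; mPtr ≔ ⋆mPtr + 1 ;; mTail ≔ 0 ;; .fill mCdf (fun _ => 0) L ;;
  .countdown mEnt
    (mTail ≔ ⋆mTail + massExpr * (valueExpr e - .const L * ⋆mUnit) ;;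
     .fill mCdf (fun j => .get mCdf (.const j) +
        massExpr * ltExpr (valueExpr e) (.const (j + 1) * ⋆mUnit)) L ;;
     mPtr ≔ ⋆mPtr + 4)

/-- The digit at position `j` of `z`. -/
def digitExpr (j : ℕ) (z : Expr) : Expr :=
  z / .pow ⋆mBase j - z / .pow ⋆mBase j / ⋆mBase * ⋆mBase

/-- The state that the state `mIdx` moves to when the current arm is chosen. -/
def shiftExpr (L : ℕ) : Expr :=
  .sum (fun j => digitExpr j ⋆mIdx * .get mCdf (.const j) / ⋆mDen * .pow ⋆mBase j) L +
    (⋆mIdx / .pow ⋆mBase L + 1) * .pow ⋆mBase L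

/-- Updates the table for the current arm; the truncated subtraction computes a maximum. -/
def updateTable (L : ℕ) : Cmd :=
  mTail ≔ ⋆mTail * ⋆mTop + ⋆mBit ;;
  mIdx ≔ ⋆mCap * ⋆mFull ;;
  .countdown mIdx
    (.ite (.get mTab ⋆mIdx)
      (mTmp ≔ shiftExpr L ;;
       .set mTab ⋆mTmp (.get mTab ⋆mTmp + (.get mTab ⋆mIdx + ⋆mTail - .get mTab ⋆mTmp)))
      .skip)

/-- Runs the dynamic program over all arms. -/
def fillTable (e L : ℕ) : Cmd :=
  mPtr ≔ 2 ;; mBit ≔ 1 ;; mArm ≔ .get 0 0 ;;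
  .countdown mArm (readArm e L ;; updateTable L ;; mBit ≔ ⋆mBit * 2)

/-- The state number `mIdx` among those whose counter is `min K m`. -/
def rowExpr : Expr := ⋆mIdx + ⋆mCap * ⋆mFull

/-- The estimate for the set stored at `rowExpr`. -/
def estimateExpr (L : ℕ) : Expr :=
  .sum (fun j => (⋆mBase - 1 - digitExpr j rowExpr) * (⋆mUnit * ⋆mDen)) L +
    (⋆mBase - 1) * (.get mTab rowExpr / ⋆mTop)

/-- Finds the best set of maximal size. -/
def findBest (L : ℕ) : Cmd :=
  mBest ≔ 0 ;; mIdx ≔ ⋆mFull ;;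
  .countdown mIdx
    (.ite (.get mTab rowExpr)
      (mTmp ≔ estimateExpr L ;;
       .ite (⋆mTmp - ⋆mBest) (mBest ≔ ⋆mTmp ;; mCode ≔ .get mTab rowExpr) .skip)
      .skip)

/-- Stops if the best estimate is small compared with the unit, otherwise doubles the unit. -/
def nextUnit (e : ℕ) : Cmd :=
  .ite (⋆mBest - (.const (3 * e) * ⋆mUnit * (⋆mBase - 1) * ⋆mDen + (⋆mBase - 1)))
    (mUnit ≔ ⋆mUnit * 2) (mGo ≔ 0)

/-- Writes the binary digits of the code to the output. -/
def writeOutput : Cmd :=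
  mIdx ≔ .get 0 0 ;;
  .countdown mIdx
    (mTop ≔ ⋆mTop / 2 ;; .set 1 ⋆mIdx (⋆mCode / ⋆mTop - ⋆mCode / ⋆mTop / 2 * 2))

/-- The approximation scheme: tries the units `1, 2, 4, …` until the best estimate passes the test. -/
def algorithm (e : ℕ) : Cmd :=
  readDenom ;; setup (e * e) ;;
  .while ⋆mGo (clearTable ;; fillTable e (e * e) ;; findBest (e * e) ;; nextUnit e) ;;
  writeOutput

/-! ### The numbers that the program computes from its input -/

section data

variable (inp : ℕ → ℕ)

/-- The position of the block that describes arm `a`. -/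
def offset : ℕ → ℕ
  | 0 => 2
  | a + 1 => offset a + 1 + 4 * inp (offset a)

/-- The position of entry `l` of arm `a`. -/
def entry (a l : ℕ) : ℕ := offset inp a + 1 + 4 * l

/-- The product of the denominators among the first `n` entries of arm `a`. -/
def armDenom (a n : ℕ) : ℕ :=
  ∏ l ∈ Finset.range n, inp (entry inp a l + 1) * inp (entry inp a l + 3)

/-- The product of all denominators. -/
def denom (m : ℕ) : ℕ := ∏ a ∈ Finset.range m, armDenom inp a (inp (offset inp a))

variable (D : ℕ)

/-- The scaled probability of the entry at position `p`. -/
def mass (p : ℕ) : ℕ := inp (p + 2) * (D / inp (p + 3))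

/-- The scaled value of the entry at position `p`. -/
def scaled (e p : ℕ) : ℕ := inp p * (D / inp (p + 1)) * D * e

/-- The distribution function of arm `a` from its first `n` entries. -/
def partialCdf (e u a n j : ℕ) : ℕ :=
  ∑ l ∈ Finset.range n, mass inp D (entry inp a l) *
    if scaled inp D e (entry inp a l) < (j + 1) * u then 1 else 0

/-- The mean excess of arm `a` over `L * u` from its first `n` entries. -/
def partialTail (e L u a n : ℕ) : ℕ :=
  ∑ l ∈ Finset.range n, mass inp D (entry inp a l) * (scaled inp D e (entry inp a l) - L * u)

/-- The distribution function of arm `a`. -/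
def cdf (e u a : ℕ) : ℕ → ℕ := partialCdf inp D e u a (inp (offset inp a))

/-- The mean excess of arm `a` over `L * u`. -/
def tail (e L u a : ℕ) : ℕ := partialTail inp D e L u a (inp (offset inp a))

/-- The weight of arm `a`: its mean excess, and a mark for `a` in the low `m` bits. -/
def weight (m e L u a : ℕ) : ℕ := tail inp D e L u a * 2 ^ m + 2 ^ a

theorem offset_mono : Monotone (offset inp) :=
  monotone_nat_of_le_succ fun a => by simp only [offset]; omega

end data

/-! ### Correctness of the program -/

section correctness

variable {inp : ℕ → ℕ} {m K e L D b u R H B : ℕ} {σ : State} {Q : State → Prop}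

theorem run_readDenom (h0 : σ 0 = inp) (hm : inp 0 = m) (hmH : m ≤ H)
    (hs : ∀ a < m, inp (offset inp a) ≤ H) (hB : B < 2 ^ R) (hHB : H ≤ B)
    (hoff : offset inp m ≤ B) (htop : 2 ^ m ≤ B) (hD : denom inp m ≤ B) (hD0 : 0 < denom inp m)
    (hQ : ∀ τ, Agree [mDen, mPtr, mArm, mEnt, mTop] τ σ → τ mDen 0 = denom inp m →
      τ mTop 0 = 2 ^ m → Q τ) :
    Runs R H readDenom σ Q := by
  have hsz : ∀ {x}, x ≤ B → x.size ≤ R := fun h => size_le_of_le h hB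
  have hB2 : 2 ≤ B := le_trans (offset_mono inp (Nat.zero_le m)) hoff
  refine Runs.assign_seq (hsz (by simp; omega)) ?_
  refine Runs.assign_seq (hsz (by simp; omega)) ?_
  refine Runs.assign_seq (hsz (by simpa)) ?_
  refine Runs.assign_seq (hsz (by simp [h0, hm]; omega)) ?_
  refine Runs.countdown_up (n := m) (fun a τ => Agree [mDen, mPtr, mArm, mEnt, mTop] τ σ ∧
    τ mDen 0 = denom inp a ∧ τ mTop 0 = 2 ^ a ∧ τ mPtr 0 = offset inp a) hmH (by simp [h0, hm]) ?_ ?_ ?_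
  · refine ⟨?_, by simp [denom], by simp, by simp [offset]⟩
    intro a ha
    simp at ha
    simp [ha]
  · rintro a τ ha ⟨hf, hden, htop', hptr⟩
    have hτ0 : τ 0 = inp := (hf 0 (by simp)).trans h0
    have hent := hs a ha
    have hoffa : offset inp (a + 1) ≤ B := (offset_mono inp ha).trans hoff
    have hle : denom inp (a + 1) ≤ B :=
      (Nat.le_of_dvd hD0 (Finset.prod_dvd_prod_of_subset _ _ _
        (Finset.range_subset_range.2 ha))).trans hD
    have hpos : 0 < denom inp (a + 1) := Nat.pos_of_dvd_of_pos
      (Finset.prod_dvd_prod_of_subset _ _ _ (Finset.range_subset_range.2 ha)) hD0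
    rw [denom, Finset.prod_range_succ, ← denom] at hle hpos
    rw [offset] at hoffa
    refine Runs.assign_seq (hsz (by simp [hτ0, hptr]; omega)) ?_
    refine Runs.assign_seq (hsz (by simp [hptr]; omega)) (Runs.seq ?_)
    refine Runs.countdown_up (n := inp (offset inp a)) (fun l ρ =>
      Agree [mDen, mPtr, mArm, mEnt, mTop] ρ σ ∧ ρ mDen 0 = denom inp a * armDenom inp a l ∧
      ρ mTop 0 = 2 ^ a ∧ ρ mPtr 0 = entry inp a l ∧ ρ mArm 0 = m - (a + 1)) hent
      (by simp [hτ0, hptr]) ?_ ?_ ?_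
    · refine ⟨fun x hx => ?_, by simp [hden, armDenom], by simp [htop'], by simp [hptr, entry],
        by simp⟩
      have := hf x hx
      simp at hx
      simp [hx, this]
    · rintro l ρ hl ⟨hf, hden, htop', hptr, harm⟩
      have hρ0 : ρ 0 = inp := (hf 0 (by simp)).trans h0
      have hdvd : armDenom inp a (l + 1) ∣ armDenom inp a (inp (offset inp a)) :=
        Finset.prod_dvd_prod_of_subset _ _ _ (Finset.range_subset_range.2 hl)
      have hle' : denom inp a * armDenom inp a (l + 1) ≤ B :=
        (Nat.le_of_dvd hpos (Nat.mul_dvd_mul_left _ hdvd)).trans hle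
      rw [armDenom, Finset.prod_range_succ, ← armDenom, ← mul_assoc] at hle'
      refine Runs.assign_seq (hsz (by simpa [hρ0, hptr, hden] using hle')) ?_
      refine Runs.assign (hsz (by simp [hptr, entry]; omega)) ?_
      refine ⟨⟨fun x hx => ?_, ?_, by simp [htop'], by simp [hptr, entry]; ring, by simp [harm]⟩,
        by simp⟩
      · have := hf x hx
        simp at hx
        simp [hx, this]
      · rw [armDenom, Finset.prod_range_succ, ← armDenom, ← mul_assoc]
        simp [hden, hρ0, hptr]
    · rintro ρ ⟨hf, hden, htop', hptr, harm⟩ _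
      have h2 : 2 ^ (a + 1) ≤ B := (Nat.pow_le_pow_right (by norm_num) ha).trans htop
      rw [pow_succ] at h2
      refine Runs.assign (hsz (by simpa [htop'] using h2)) ?_
      refine ⟨⟨fun x hx => ?_, ?_, by simp [htop', pow_succ], by simp [hptr, offset, entry]⟩,
        by simp [harm]⟩
      · have := hf x hx
        simp at hx
        simp [hx, this]
      · rw [denom, Finset.prod_range_succ, ← denom]
        simp [hden]
  · rintro τ ⟨hf, h₁, h₂, _⟩ _
    exact hQ τ hf h₁ h₂

/-- The memory cells that stay fixed after the set-up. -/
structure Static (inp : ℕ → ℕ) (m K b L D : ℕ) (σ : State) : Prop where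
  inp : σ 0 = inp
  den : σ mDen 0 = D
  top : σ mTop 0 = 2 ^ m
  base : σ mBase 0 = b
  full : σ mFull 0 = b ^ L
  cap : σ mCap 0 = min K m

theorem Static.of_agree {X : List ℕ} {τ : State} (h : Static inp m K b L D σ) (hX : Agree X τ σ)
    (hd : ∀ a ∈ [0, mDen, mTop, mBase, mFull, mCap], a ∉ X) : Static inp m K b L D τ := by
  simp only [List.mem_cons, List.not_mem_nil, or_false, forall_eq_or_imp, forall_eq] at hd
  obtain ⟨h₁, h₂, h₃, h₄, h₅, h₆⟩ := hd
  exact ⟨(hX _ h₁).trans h.inp, hX _ h₂ ▸ h.den, hX _ h₃ ▸ h.top, hX _ h₄ ▸ h.base,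
    hX _ h₅ ▸ h.full, hX _ h₆ ▸ h.cap⟩

theorem run_setup (h0 : σ 0 = inp) (hm : inp 0 = m) (hK : inp 1 = K) (hden : σ mDen 0 = D)
    (htop : σ mTop 0 = 2 ^ m) (hB : B < 2 ^ R) (hb : L * m + 2 = b) (hbB : b ≤ B)
    (hfull : b ^ L ≤ B) (hmB : m ≤ B) (hB1 : 1 ≤ B)
    (hQ : ∀ τ, Static inp m K b L D τ → Agree [mBase, mFull, mCap, mUnit, mGo] τ σ →
      τ mUnit 0 = 1 → τ mGo 0 = 1 → Q τ) :
    Runs R H (setup L) σ Q := by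
  have hsz : ∀ {x}, x ≤ B → x.size ≤ R := fun h => size_le_of_le h hB
  refine Runs.assign_seq (hsz (by simp [h0, hm]; omega)) ?_
  refine Runs.assign_seq (hsz (by simpa [h0, hm, hb])) ?_
  refine Runs.assign_seq (hsz (by simp [h0, hm, hK]; omega)) ?_
  refine Runs.assign_seq (hsz (by simpa)) ?_
  refine Runs.assign (hsz (by simpa)) ?_
  refine hQ _ ⟨by simp [h0], by simp [hden], by simp [htop], by simp [h0, hm, hb],
    by simp [h0, hm, hb], by simp [h0, hm, hK]; omega⟩ (fun x hx => ?_) (by simp) (by simp)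
  simp at hx
  simp [hx]

theorem run_clearTable (hst : Static inp m K b L D σ) (hB : B < 2 ^ R) (hHB : H ≤ B)
    (htot : (min K m + 1) * b ^ L ≤ H) (htop : 2 ^ m ≤ B)
    (hz : ∀ z, (min K m + 1) * b ^ L ≤ z → σ mTab z = 0)
    (hQ : ∀ τ, Agree [mIdx, mTab] τ σ → τ mTab = Function.update (0 : ℕ → ℕ) (b ^ L - 1) (2 ^ m) → Q τ) :
    Runs R H clearTable σ Q := by
  have hsz : ∀ {x}, x ≤ B → x.size ≤ R := fun h => size_le_of_le h hB
  refine Runs.assign_seq (hsz (by simp [hst.cap, hst.full]; omega)) (Runs.seq ?_)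
  refine Runs.countdown (n := (min K m + 1) * b ^ L) (fun k τ =>
    Agree [mIdx, mTab] τ σ ∧ ∀ z, k ≤ z → τ mTab z = 0) htot (by simp [hst.cap, hst.full]) ?_ ?_ ?_
  · refine ⟨fun x hx => ?_, by simpa using hz⟩
    simp at hx
    simp [hx]
  · rintro k τ _ ⟨hf, hk⟩ _
    refine Runs.set (by simp) ⟨⟨fun x hx => ?_, fun z hz => ?_⟩, by simp⟩
    · have := hf x hx
      simp at hx
      simp [hx, this]
    · by_cases h : z = k
      · simp [h]
      · simpa [h] using hk z (by omega)
  · rintro τ ⟨hf, h0⟩ _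
    have hst := hst.of_agree hf (by simp)
    refine Runs.set (hsz (by simpa [hst.top])) (hQ _ (fun x hx => ?_) ?_)
    · have := hf x hx
      simp at hx
      simp [hx, this]
    · funext z
      simp [hst.top, hst.full, Function.update_apply, h0]

theorem eval_massExpr {p : ℕ} (h0 : σ 0 = inp) (hp : σ mPtr 0 = p) (hD : σ mDen 0 = D) :
    massExpr.eval σ = mass inp D p := by
  simp [massExpr, mass, h0, hp, hD]

theorem eval_valueExpr {p : ℕ} (h0 : σ 0 = inp) (hp : σ mPtr 0 = p) (hD : σ mDen 0 = D) :
    (valueExpr e).eval σ = scaled inp D e p := by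
  simp [valueExpr, scaled, h0, hp, hD]

theorem eval_ltExpr (x y : Expr) :
    (ltExpr x y).eval σ = if x.eval σ < y.eval σ then 1 else 0 := by
  simp only [ltExpr, Expr.eval_sub, Expr.eval_ofNat]
  split_ifs <;> omega

theorem run_readArm {a : ℕ} (hst : Static inp m K b L D σ) (hB : B < 2 ^ R)
    (hptr : σ mPtr 0 = offset inp a) (hunit : σ mUnit 0 = u) (hs : inp (offset inp a) ≤ H)
    (hHB : H ≤ B) (hoff : offset inp (a + 1) ≤ B) (htail : tail inp D e L u a ≤ B)
    (hcdf : ∀ j < L, cdf inp D e u a j ≤ B)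
    (hQ : ∀ τ, Agree [mEnt, mPtr, mTail, mCdf] τ σ → τ mPtr 0 = offset inp (a + 1) →
      τ mTail 0 = tail inp D e L u a → (∀ j < L, τ mCdf j = cdf inp D e u a j) → Q τ) :
    Runs R H (readArm e L) σ Q := by
  have hsz : ∀ {x}, x ≤ B → x.size ≤ R := fun h => size_le_of_le h hB
  rw [offset] at hoff
  refine Runs.assign_seq (hsz (by simp [hst.inp, hptr]; omega)) ?_
  refine Runs.assign_seq (hsz (by simp [hptr]; omega)) ?_
  refine Runs.assign_seq (hsz (by simp)) (Runs.seq ?_)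
  refine Runs.fill (fun _ => 0) (fun _ _ _ _ => rfl) (by simp) ?_
  refine Runs.countdown_up (n := inp (offset inp a)) (fun l τ =>
    Agree [mEnt, mPtr, mTail, mCdf] τ σ ∧ τ mPtr 0 = entry inp a l ∧
      τ mTail 0 = partialTail inp D e L u a l ∧
      ∀ j < L, τ mCdf j = partialCdf inp D e u a l j) hs (by simp [hst.inp, hptr]) ?_ ?_ ?_
  · refine ⟨fun x hx => ?_, by simp [hptr, entry], by simp [partialTail], fun j hj => ?_⟩
    · simp at hx
      simp [hx]
    · simp [hj, partialCdf]
  · rintro l τ hl ⟨hf, hptr, htl, hcd⟩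
    have hst' := hst.of_agree hf (by simp)
    have hunit' : τ mUnit 0 = u := by rw [hf _ (by simp), hunit]
    have hsub : Finset.range (l + 1) ⊆ Finset.range (inp (offset inp a)) :=
      Finset.range_subset_range.2 hl
    have hT : partialTail inp D e L u a (l + 1) ≤ B := (Finset.sum_le_sum_of_subset hsub).trans htail
    have hC : ∀ j < L, partialCdf inp D e u a (l + 1) j ≤ B := fun j hj =>
      (Finset.sum_le_sum_of_subset hsub).trans (hcdf j hj)
    set ρ := τ.write mEnt 0 (inp (offset inp a) - (l + 1)) with hρ
    have h0 : ρ 0 = inp := by simp [hρ, hst'.inp]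
    have hp : ρ mPtr 0 = entry inp a l := by simp [hρ, hptr]
    have hD : ρ mDen 0 = D := by simp [hρ, hst'.den]
    have e₁ : ((⋆mTail : Expr) + massExpr * (valueExpr e - .const L * ⋆mUnit)).eval ρ =
        partialTail inp D e L u a (l + 1) := by
      rw [partialTail, Finset.sum_range_succ, ← partialTail]
      simp only [Expr.eval_add, Expr.eval_mul, Expr.eval_sub, eval_massExpr h0 hp hD,
        eval_valueExpr h0 hp hD]
      simp [hρ, htl, hunit']
    refine Runs.assign_seq (hsz (e₁ ▸ hT)) (Runs.seq ?_)
    rw [e₁]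
    refine Runs.fill (fun j => partialCdf inp D e u a (l + 1) j) (fun j hj θ hθ => ?_)
      (fun j hj => hsz (hC j hj)) (Runs.assign (hsz ?_) ⟨⟨fun x hx => ?_, ?_, ?_, fun j hj => ?_⟩, ?_⟩)
    · have h0' : θ 0 = inp := by
        funext x
        rw [hθ _ _ (.inl (by simp))]
        simp [h0]
      have hp' : θ mPtr 0 = entry inp a l := by
        rw [hθ _ _ (.inl (by simp))]
        simp [hp]
      have hD' : θ mDen 0 = D := by
        rw [hθ _ _ (.inl (by simp))]
        simp [hD]
      have hu' : θ mUnit 0 = u := by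
        rw [hθ _ _ (.inl (by simp))]
        simp [hρ, hunit']
      have hc' : θ mCdf j = partialCdf inp D e u a l j := by
        rw [hθ _ _ (.inr le_rfl)]
        simp [hρ, hcd j hj]
      rw [partialCdf, Finset.sum_range_succ, ← partialCdf]
      simp only [Expr.eval_add, Expr.eval_mul, eval_massExpr h0' hp' hD', eval_ltExpr,
        eval_valueExpr h0' hp' hD']
      simp [hc', hu']
    · simp [hp, entry]
      omega
    · have := hf x hx
      simp at hx
      funext y
      simp [hx, hρ, this]
    · simp [hp, entry]
      ring
    · simp
    · simp [hj]
    · simp [hρ]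
  · rintro τ ⟨hf, hptr, htl, hcd⟩ _
    exact hQ τ hf (by simp [hptr, offset, entry]) htl hcd

theorem eval_digitExpr (hb : σ mBase 0 = b) (j : ℕ) (z : Expr) :
    (digitExpr j z).eval σ = digit b j (z.eval σ) := by
  simp only [digitExpr, digit, Expr.eval_sub, Expr.eval_mul, Expr.eval_div, Expr.eval_pow,
    Expr.eval_var, hb, Nat.mod_eq_sub_div_mul]

theorem eval_shiftExpr (hst : Static inp m K b L D σ) {q : ℕ → ℕ} (hq : ∀ j < L, σ mCdf j = q j) :
    (shiftExpr L).eval σ = shift b L D q (σ mIdx 0) := by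
  simp only [shiftExpr, shift, Expr.eval_add, Expr.eval_mul, Expr.eval_div, Expr.eval_pow,
    Expr.eval_var, Expr.eval_sum, Expr.eval_get, Expr.eval_const, Expr.eval_ofNat, hst.base,
    hst.den, eval_digitExpr hst.base]
  congr 1
  exact Finset.sum_congr rfl fun j hj => by rw [hq j (Finset.mem_range.1 hj)]

theorem _root_.KnapsackTable.Table.le {tr : ℕ → ℕ → ℕ} {w : ℕ → ℕ} {z₀ w₀ bound i : ℕ} {T : ℕ → ℕ}
    (h : Table tr w z₀ w₀ bound i T) (hw : ∀ S ⊆ Finset.range i, w₀ + ∑ a ∈ S, w a ≤ B) (z : ℕ) :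
    T z ≤ B := by
  by_cases hz : T z = 0
  · omega
  · obtain ⟨S, hS, _, h⟩ := h.sound z hz
    exact h ▸ hw S hS

theorem _root_.KnapsackTable.Table.add_le {tr : ℕ → ℕ → ℕ} {w : ℕ → ℕ} {z₀ w₀ bound i : ℕ} {T : ℕ → ℕ}
    (h : Table tr w z₀ w₀ bound i T)
    (hw : ∀ S ⊆ Finset.range (i + 1), w₀ + ∑ a ∈ S, w a ≤ B) {z : ℕ} (hz : T z ≠ 0) :
    T z + w i ≤ B := by
  obtain ⟨S, hS, _, h⟩ := h.sound z hz
  have hi : i ∉ S := fun h => by simpa using hS h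
  have := hw (insert i S) (by
    rw [Finset.range_add_one]
    exact Finset.insert_subset_insert i hS)
  rw [Finset.sum_insert hi] at this
  omega

theorem run_updateTable {a T : ℕ} {q : ℕ → ℕ → ℕ} {w : ℕ → ℕ} (hst : Static inp m K b L D σ)
    (hB : B < 2 ^ R) (hb : 0 < b) (hHB : H ≤ B) (htot : (min K m + 1) * b ^ L ≤ H)
    (htail : σ mTail 0 = T) (hbit : σ mBit 0 = 2 ^ a) (hT : T * 2 ^ m + 2 ^ a = w a)
    (hq : ∀ i ≤ a, ∀ j < L, q i j ≤ D) (hcdf : ∀ j < L, σ mCdf j = q a j)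
    (hw : ∀ S ⊆ Finset.range (a + 1), 2 ^ m + ∑ a ∈ S, w a ≤ B)
    (htab : Table (fun i => shift b L D (q i)) w (b ^ L - 1) (2 ^ m) (min K m) a (σ mTab))
    (hz : ∀ z, (min K m + 1) * b ^ L ≤ z → σ mTab z = 0)
    (hQ : ∀ τ, Agree [mTail, mIdx, mTmp, mTab] τ σ →
      Table (fun i => shift b L D (q i)) w (b ^ L - 1) (2 ^ m) (min K m) (a + 1) (τ mTab) →
      (∀ z, (min K m + 1) * b ^ L ≤ z → τ mTab z = 0) → Q τ) :
    Runs R H (updateTable L) σ Q := by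
  have hsz : ∀ {x}, x ≤ B → x.size ≤ R := fun h => size_le_of_le h hB
  have hwa : w a ≤ B := by
    have := hw {a} (by simp)
    rw [Finset.sum_singleton] at this
    exact (Nat.le_add_left _ _).trans this
  have hX : min K m * b ^ L ≤ (min K m + 1) * b ^ L := Nat.mul_le_mul_right _ (Nat.le_succ _)
  refine Runs.assign_seq (hsz (by simpa [htail, hst.top, hbit, hT])) ?_
  refine Runs.assign_seq (hsz (by simp [hst.cap, hst.full]; omega)) ?_
  refine Runs.countdown (n := min K m * b ^ L) (fun x τ =>
    Agree [mTail, mIdx, mTmp, mTab] τ σ ∧ τ mTail 0 = w a ∧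
      Partial (shift b L D (q a)) (w a) (min K m * b ^ L) (σ mTab) x (τ mTab) ∧
      ∀ z, (min K m + 1) * b ^ L ≤ z → τ mTab z = 0) (hX.trans htot)
      (by simp [hst.cap, hst.full]) ?_ ?_ ?_
  · refine ⟨fun x hx => ?_, by simp [htail, hst.top, hbit, hT], by simpa using Partial.init _ _ _ _,
      by simpa using hz⟩
    simp at hx
    simp [hx]
  · rintro x τ hx ⟨hf, htl, hp, hz'⟩ _
    have hf' : Agree [mTail, mIdx, mTmp, mTab] (τ.write mIdx 0 x) σ := fun y hy => by
      have := hf y hy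
      simp at hy
      simp [hy, this]
    have hst' := hst.of_agree hf' (by simp)
    have htab' : (τ.write mIdx 0 x) mTab = τ mTab := by simp
    have hlt := lt_shift (q := q a) (L := L) (D := D) hb x
    have hlt' := shift_lt hb (hq a le_rfl) x hx
    refine Runs.ite (fun hc => ?_) (fun hc => ?_)
    · have h0 : τ mTab x ≠ 0 := by simpa using hc
      have e₁ : (shiftExpr L).eval (τ.write mIdx 0 x) = shift b L D (q a) x := by
        rw [eval_shiftExpr hst' (q := q a) fun j hj => by simp [hf mCdf, hcdf j hj]]
        simp
      have hnew := hp.step hx h0 hlt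
      have hval : max (τ mTab (shift b L D (q a) x)) (τ mTab x + w a) ≤ B := by
        have hx' : τ mTab x = σ mTab x := hp.eq x (by omega)
        refine max_le ?_ ?_
        · by_cases hy : τ mTab (shift b L D (q a) x) = 0
          · omega
          · rcases hp.sound _ hy with h | ⟨z', _, hz', _, h⟩
            · rw [h]
              exact htab.le (fun S hS => hw S (hS.trans (by simp))) _
            · rw [h]
              exact htab.add_le hw hz'
        · rw [hx'] at h0 ⊢
          exact htab.add_le hw h0
      refine Runs.assign_seq (hsz (by rw [e₁]; omega)) ?_
      rw [e₁]
      have e₂ : (Expr.get mTab ⋆mTmp + (.get mTab ⋆mIdx + ⋆mTail - .get mTab ⋆mTmp)).eval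
          ((τ.write mIdx 0 x).write mTmp 0 (shift b L D (q a) x)) =
          max (τ mTab (shift b L D (q a) x)) (τ mTab x + w a) := by
        simp [htl]
        omega
      refine Runs.set (hsz (e₂ ▸ hval)) ?_
      rw [e₂]
      refine ⟨⟨fun y hy => ?_, by simp [htl], by simpa using hnew, fun z hz => ?_⟩, by simp⟩
      · have := hf y hy
        simp at hy
        simp [hy, this]
      · have : z ≠ shift b L D (q a) x := by omega
        simpa [this] using hz' z hz
    · have h0 : τ mTab x = 0 := by simpa using hc
      exact Runs.skip ⟨⟨hf', by simp [htl], by simpa using hp.step_zero h0, by simpa using hz'⟩,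
        by simp⟩
  · rintro τ ⟨hf, _, hp, hz'⟩ _
    refine hQ τ hf (htab.succ (by positivity) hp fun S hS hc => ?_) hz'
    have := reach_div (S := S) (q := q) (D := D) (L := L) (m := a) hb
      fun i hi => hq i (by omega)
    rw [Finset.inter_eq_left.2 hS] at this
    rw [← Nat.div_lt_iff_lt_mul (by positivity), this]
    exact hc

/-- The bounds under which the program runs: `B` bounds the contents of all cells, and `H` the number
of iterations of every loop. -/
structure Fits (inp : ℕ → ℕ) (m K b L D R H B : ℕ) : Prop where
  pow : B < 2 ^ R
  iter : H ≤ B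
  base : L * m + 2 = b
  table : (min K m + 1) * b ^ L ≤ H
  arms : m ≤ H
  entries : ∀ a < m, inp (offset inp a) ≤ H
  offset : offset inp m ≤ B
  top : 2 ^ m ≤ B
  den : D ≤ B

/-- The bounds that depend on the unit. -/
structure FitsUnit (inp : ℕ → ℕ) (m e b L D B u : ℕ) : Prop where
  cdf : ∀ a < m, ∀ j < L, cdf inp D e u a j ≤ D
  weight : ∀ S ⊆ Finset.range m, 2 ^ m + ∑ a ∈ S, weight inp D m e L u a ≤ B
  value : ∀ z, ∀ S ⊆ Finset.range m,
    value b L D u z (1 + ∑ a ∈ S, tail inp D e L u a) ≤ B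

theorem run_fillTable (hst : Static inp m K b L D σ) (hf : Fits inp m K b L D R H B)
    (hu : FitsUnit inp m e b L D B u) (hm : inp 0 = m) (hunit : σ mUnit 0 = u)
    (htab : σ mTab = Function.update (0 : ℕ → ℕ) (b ^ L - 1) (2 ^ m))
    (hQ : ∀ τ, Agree [mPtr, mBit, mArm, mEnt, mTail, mCdf, mIdx, mTmp, mTab] τ σ →
      Table (fun i => shift b L D (cdf inp D e u i)) (weight inp D m e L u) (b ^ L - 1) (2 ^ m)
        (min K m) m (τ mTab) →
      (∀ z, (min K m + 1) * b ^ L ≤ z → τ mTab z = 0) → Q τ) :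
    Runs R H (fillTable e L) σ Q := by
  have hsz : ∀ {x}, x ≤ B → x.size ≤ R := fun h => size_le_of_le h hf.pow
  have hb : 0 < b := by have := hf.base; omega
  have hfull : 0 < b ^ L := by positivity
  have hB2 : 2 ≤ B := le_trans (offset_mono inp (Nat.zero_le m)) hf.offset
  have hmB := hf.arms.trans hf.iter
  refine Runs.assign_seq (hsz (by simpa)) ?_
  refine Runs.assign_seq (hsz (by simp; omega)) ?_
  refine Runs.assign_seq (hsz (by simpa [hst.inp, hm])) ?_
  refine Runs.countdown_up (n := m) (fun a τ =>
    Agree [mPtr, mBit, mArm, mEnt, mTail, mCdf, mIdx, mTmp, mTab] τ σ ∧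
      τ mPtr 0 = KMaxProgram.offset inp a ∧ τ mBit 0 = 2 ^ a ∧
      Table (fun i => shift b L D (cdf inp D e u i)) (weight inp D m e L u) (b ^ L - 1) (2 ^ m)
        (min K m) a (τ mTab) ∧ ∀ z, (min K m + 1) * b ^ L ≤ z → τ mTab z = 0) hf.arms
    (by simp [hst.inp, hm]) ?_ ?_ ?_
  · refine ⟨fun x hx => ?_, by simp [KMaxProgram.offset], by simp, ?_, fun z hz => ?_⟩
    · simp at hx
      simp [hx]
    · simpa [htab] using Table.init
    · have : z ≠ b ^ L - 1 := by
        have : 1 * b ^ L ≤ (min K m + 1) * b ^ L := Nat.mul_le_mul_right _ (by omega)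
        omega
      simp [htab, this]
  · rintro a τ ha ⟨hag, hptr, hbit, ht, hz⟩
    have hag' : Agree [mPtr, mBit, mArm, mEnt, mTail, mCdf, mIdx, mTmp, mTab]
        (τ.write mArm 0 (m - (a + 1))) σ := fun y hy => by
      have := hag y hy
      simp at hy
      simp [hy, this]
    have hsub : Finset.range (a + 1) ⊆ Finset.range m := Finset.range_subset_range.2 ha
    have htail : tail inp D e L u a ≤ B := by
      have := hu.value 0 {a} (by simpa using ha)
      have hN : 1 ≤ b - 1 := by have := hf.base; omega
      rw [KnapsackTable.value, Finset.sum_singleton] at this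
      have := Nat.mul_le_mul_right (1 + tail inp D e L u a) hN
      omega
    refine Runs.seq (run_readArm (hst.of_agree hag' (by simp)) hf.pow (by simp [hptr])
      ((congrFun (hag' mUnit (by simp)) 0).trans hunit) (hf.entries a ha) hf.iter
      ((offset_mono inp ha).trans hf.offset) htail
      (fun j hj => (hu.cdf a ha j hj).trans hf.den) fun ρ hρ hρp hρt hρc => Runs.seq ?_)
    have hst' := (hst.of_agree hag' (by simp)).of_agree hρ (by simp)
    have hρb : ρ mBit 0 = 2 ^ a := by rw [hρ mBit (by simp)]; simp [hbit]
    have hρT : ρ mTab = τ mTab := by rw [hρ mTab (by simp)]; simp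
    refine run_updateTable hst' hf.pow hb hf.iter hf.table hρt hρb rfl
      (fun i hi => hu.cdf i (by omega)) hρc (fun S hS => hu.weight S (hS.trans hsub))
      (hρT ▸ ht) (hρT ▸ hz) fun θ hθ hθt hθz => ?_
    have hθb : θ mBit 0 = 2 ^ a := by rw [hθ mBit (by simp), hρb]
    have h2 : 2 ^ (a + 1) ≤ B := (Nat.pow_le_pow_right (by norm_num) ha).trans hf.top
    rw [pow_succ] at h2
    refine Runs.assign (hsz (by simpa [hθb] using h2)) ⟨⟨fun x hx => ?_, ?_, ?_, ?_, ?_⟩, ?_⟩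
    · have h₁ := hag x hx
      simp at hx
      have h₂ := hρ x (by simp [hx])
      have h₃ := hθ x (by simp [hx])
      simp [hx, h₁, h₂, h₃]
    · simp [hθ mPtr, hρp]
    · simp [hθb, pow_succ]
    · simpa using hθt
    · simpa using hθz
    · simp [hθ mArm, hρ mArm]
  · rintro τ ⟨hag, _, _, ht, hz⟩ _
    exact hQ τ hag ht hz

/-- The weight of a set lists its elements in the low `m` bits, below its total mean excess. -/
theorem weight_eq (T : ℕ → ℕ) {S : Finset ℕ} (hS : S ⊆ Finset.range m) :
    2 ^ m + ∑ a ∈ S, (T a * 2 ^ m + 2 ^ a) =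
      ∑ j ∈ Finset.range m, (if j ∈ S then 1 else 0) * 2 ^ j + (1 + ∑ a ∈ S, T a) * 2 ^ m := by
  have : ∑ j ∈ Finset.range m, (if j ∈ S then 1 else 0) * 2 ^ j = ∑ a ∈ S, 2 ^ a := by
    simp only [ite_mul, one_mul, zero_mul]
    rw [← Finset.sum_filter, Finset.filter_mem_eq_inter, Finset.inter_eq_right.2 hS]
  rw [this, Finset.sum_add_distrib, ← Finset.sum_mul]
  ring

theorem weight_div (T : ℕ → ℕ) {S : Finset ℕ} (hS : S ⊆ Finset.range m) :
    (2 ^ m + ∑ a ∈ S, (T a * 2 ^ m + 2 ^ a)) / 2 ^ m = 1 + ∑ a ∈ S, T a := by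
  rw [weight_eq T hS, digits_div (c := fun j => if j ∈ S then 1 else 0)]
  intro j _
  split_ifs <;> norm_num

theorem digit_weight (T : ℕ → ℕ) {S : Finset ℕ} (hS : S ⊆ Finset.range m) {i : ℕ} (hi : i < m) :
    digit 2 i (2 ^ m + ∑ a ∈ S, (T a * 2 ^ m + 2 ^ a)) = if i ∈ S then 1 else 0 := by
  rw [weight_eq T hS, digit_digits (c := fun j => if j ∈ S then 1 else 0) _ _ _ hi]
  intro j _
  split_ifs <;> norm_num

theorem value_mono (b L D u z : ℕ) {g g' : ℕ} (h : g ≤ g') :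
    value b L D u z g ≤ value b L D u z g' :=
  Nat.add_le_add_left (Nat.mul_le_mul_left _ h) _

theorem eval_estimateExpr (hst : Static inp m K b L D σ) (hunit : σ mUnit 0 = u) :
    (estimateExpr L).eval σ = value b L D u (σ mIdx 0 + min K m * b ^ L)
      (σ mTab (σ mIdx 0 + min K m * b ^ L) / 2 ^ m) := by
  simp only [estimateExpr, rowExpr, value, Expr.eval_add, Expr.eval_mul, Expr.eval_div,
    Expr.eval_sub, Expr.eval_var, Expr.eval_sum, Expr.eval_get, Expr.eval_ofNat, hst.base, hst.den,
    hst.cap, hst.full, hst.top, hunit, eval_digitExpr hst.base]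

theorem run_findBest {q : ℕ → ℕ → ℕ} {T : ℕ → ℕ} (hst : Static inp m K b L D σ)
    (hf : Fits inp m K b L D R H B) (hunit : σ mUnit 0 = u)
    (hq : ∀ i < m, ∀ j < L, q i j ≤ D)
    (hw : ∀ S ⊆ Finset.range m, 2 ^ m + ∑ a ∈ S, (T a * 2 ^ m + 2 ^ a) ≤ B)
    (hv : ∀ z, ∀ S ⊆ Finset.range m, value b L D u z (1 + ∑ a ∈ S, T a) ≤ B)
    (htab : Table (fun i => shift b L D (q i)) (fun a => T a * 2 ^ m + 2 ^ a) (b ^ L - 1) (2 ^ m)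
      (min K m) m (σ mTab))
    (hQ : ∀ τ, Agree [mBest, mIdx, mTmp, mCode] τ σ →
      (∃ S ⊆ Finset.range m, S.card = min K m ∧
        τ mCode 0 = 2 ^ m + ∑ a ∈ S, (T a * 2 ^ m + 2 ^ a) ∧
        τ mBest 0 = estimate m b L D u q T S ∧
        ∀ S' ⊆ Finset.range m, S'.card = min K m →
          estimate m b L D u q T S' ≤ estimate m b L D u q T S) → Q τ) :
    Runs R H (findBest L) σ Q := by
  have hsz : ∀ {x}, x ≤ B → x.size ≤ R := fun h => size_le_of_le h hf.pow
  have hb : 0 < b := by have := hf.base; omega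
  have hfull : 0 < b ^ L := by positivity
  have hfullH : b ^ L ≤ H := le_trans (Nat.le_mul_of_pos_left _ (by omega)) hf.table
  have hreach : ∀ S ⊆ Finset.range m,
      reach (fun i => shift b L D (q i)) (b ^ L - 1) S m / b ^ L = S.card := fun S hS => by
    rw [reach_div hb hq, Finset.inter_eq_left.2 hS]
  set cf := min K m * b ^ L with hcf
  set val : ℕ → ℕ := fun z => value b L D u (z + cf) (σ mTab (z + cf) / 2 ^ m) with hval
  refine Runs.assign_seq (hsz (by simp)) ?_
  refine Runs.assign_seq (hsz (by simpa [hst.full] using hfullH.trans hf.iter)) ?_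
  refine Runs.countdown (n := b ^ L) (fun x τ =>
    Agree [mBest, mIdx, mTmp, mCode] τ σ ∧
      (∀ z, x ≤ z → z < b ^ L → σ mTab (z + cf) ≠ 0 → val z ≤ τ mBest 0) ∧
      (τ mBest 0 = 0 ∨ ∃ z < b ^ L, σ mTab (z + cf) ≠ 0 ∧ τ mCode 0 = σ mTab (z + cf) ∧
        τ mBest 0 = val z)) hfullH (by simp [hst.full]) ?_ ?_ ?_
  · refine ⟨fun x hx => ?_, fun z h₁ h₂ => by omega, by simp⟩
    simp at hx
    simp [hx]
  · rintro x τ hx ⟨hag, hle, hex⟩ _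
    have hag' : Agree [mBest, mIdx, mTmp, mCode] (τ.write mIdx 0 x) σ := fun y hy => by
      have := hag y hy
      simp at hy
      simp [hy, this]
    have hst' := hst.of_agree hag' (by simp)
    have htab' : τ mTab = σ mTab := hag mTab (by simp)
    have hrow : ∀ θ : State, Static inp m K b L D θ → θ mIdx 0 = x →
        rowExpr.eval θ = x + cf := fun θ h₁ h₂ => by
      simp [rowExpr, h₁.cap, h₁.full, h₂, hcf]
    have hc₀ : (Expr.get mTab rowExpr).eval (τ.write mIdx 0 x) = σ mTab (x + cf) := by
      rw [Expr.eval_get, hrow _ hst' (by simp)]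
      simp [htab']
    refine Runs.ite (fun hc => ?_) (fun hc => ?_)
    · rw [hc₀] at hc
      have e₁ : (estimateExpr L).eval (τ.write mIdx 0 x) = val x := by
        rw [eval_estimateExpr hst' ((congrFun (hag' mUnit (by simp)) 0).trans hunit)]
        simp [hval, htab', hcf]
      have hvx : val x ≤ B := by
        obtain ⟨S, hS, _, h⟩ := htab.sound _ hc
        simp only [hval, h, weight_div T hS]
        exact hv _ S hS
      refine Runs.assign_seq (hsz (e₁ ▸ hvx)) ?_
      rw [e₁]
      have hag₂ : Agree [mBest, mIdx, mTmp, mCode] ((τ.write mIdx 0 x).write mTmp 0 (val x)) σ :=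
        fun y hy => by
          have := hag y hy
          simp at hy
          simp [hy, this]
      refine Runs.ite (fun hc' => ?_) (fun hc' => ?_)
      · have hlt : τ mBest 0 < val x := by simpa [Nat.sub_ne_zero_iff_lt] using hc'
        refine Runs.assign_seq (hsz (by simpa using hvx)) ?_
        have hag₃ : Agree [mBest, mIdx, mTmp, mCode]
            (((τ.write mIdx 0 x).write mTmp 0 (val x)).write mBest 0 (val x)) σ :=
          fun y hy => by
            have := hag y hy
            simp at hy
            simp [hy, this]
        have e₂ : (Expr.get mTab rowExpr).eval
            (((τ.write mIdx 0 x).write mTmp 0 (val x)).write mBest 0 (val x)) =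
            σ mTab (x + cf) := by
          rw [Expr.eval_get, hrow _ (hst.of_agree hag₃ (by simp)) (by simp)]
          simp [htab']
        have e₃ : (⋆mTmp : Expr).eval ((τ.write mIdx 0 x).write mTmp 0 (val x)) = val x := by
          simp
        rw [e₃]
        have hB' : σ mTab (x + cf) ≤ B := htab.le hw _
        refine Runs.assign (hsz (by rwa [e₂])) ?_
        rw [e₂]
        refine ⟨⟨fun y hy => ?_, fun z h₁ h₂ h₃ => ?_, .inr ⟨x, hx, hc, by simp, by simp⟩⟩,
          by simp⟩
        · have := hag y hy
          simp at hy
          simp [hy, this]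
        · rcases h₁.eq_or_lt with rfl | h₁
          · simp
          · simpa using (hle z h₁ h₂ h₃).trans hlt.le
      · have hlt : val x ≤ τ mBest 0 := by simpa [Nat.sub_eq_zero_iff_le] using hc'
        refine Runs.skip ⟨⟨hag₂, fun z h₁ h₂ h₃ => ?_, by simpa using hex⟩, by simp⟩
        rcases h₁.eq_or_lt with rfl | h₁
        · simpa using hlt
        · simpa using hle z h₁ h₂ h₃
    · rw [hc₀] at hc
      refine Runs.skip ⟨⟨hag', fun z h₁ h₂ h₃ => ?_, by simpa using hex⟩, by simp⟩
      rcases h₁.eq_or_lt with rfl | h₁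
      · exact absurd hc h₃
      · simpa using hle z h₁ h₂ h₃
  · rintro τ ⟨hag, hle, hex⟩ _
    have hall : ∀ S ⊆ Finset.range m, S.card = min K m →
        estimate m b L D u q T S ≤ τ mBest 0 := by
      intro S hS hc
      have h₁ := htab.complete S hS hc.le
      have h₂ := hreach S hS
      set y := reach (fun i => shift b L D (q i)) (b ^ L - 1) S m with hy
      have h₃ : y % b ^ L + cf = y := by
        rw [hcf, ← hc, ← h₂, mul_comm]
        exact Nat.mod_add_div y _
      have h₄ := hle (y % b ^ L) (Nat.zero_le _) (Nat.mod_lt _ hfull) (by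
        rw [h₃]
        have : 0 < 2 ^ m := by positivity
        omega)
      refine le_trans ?_ h₄
      simp only [hval, h₃, estimate, ← hy]
      refine value_mono _ _ _ _ _ ?_
      rw [← weight_div T hS]
      exact Nat.div_le_div_right h₁
    -- Estimates are positive, so the initial value `0` of `mBest` has been replaced.
    have hpos : τ mBest 0 ≠ 0 := by
      have h₁ := hall (Finset.range (min K m)) (Finset.range_subset_range.2 (by omega)) (by simp)
      have h₂ : 1 ≤ b - 1 := by have := hf.base; omega
      have h₃ : 1 * 1 ≤ (b - 1) * (1 + ∑ i ∈ Finset.range (min K m), T i) :=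
        Nat.mul_le_mul h₂ (by omega)
      unfold estimate value at h₁
      omega
    obtain ⟨z, hz, hz0, hcode, hbest⟩ := hex.resolve_left hpos
    obtain ⟨S, hS, hr, hw'⟩ := htab.sound _ hz0
    have hest : val z = estimate m b L D u q T S := by
      simp only [hval, estimate, hr, hw', weight_div T hS]
    refine hQ τ hag ⟨S, hS, ?_, hcode.trans hw', hbest.trans hest, fun S' hS' hc' => ?_⟩
    · rw [← hreach S hS, hr, hcf, Nat.add_mul_div_right _ _ hfull, Nat.div_eq_of_lt hz, zero_add]
    · rw [← hest, ← hbest]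
      exact hall S' hS' hc'

theorem run_writeOutput {T : ℕ → ℕ} {S : Finset ℕ} (h0 : σ 0 = inp) (hm : inp 0 = m)
    (htop : σ mTop 0 = 2 ^ m) (hS : S ⊆ Finset.range m)
    (hcode : σ mCode 0 = 2 ^ m + ∑ a ∈ S, (T a * 2 ^ m + 2 ^ a)) (hB : B < 2 ^ R) (hmH : m ≤ H)
    (hHB : H ≤ B) (htopB : 2 ^ m ≤ B)
    (hQ : ∀ τ : State, (∀ i < m, τ 1 i = if i ∈ S then 1 else 0) → Q τ) :
    Runs R H writeOutput σ Q := by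
  have hsz : ∀ {x}, x ≤ B → x.size ≤ R := fun h => size_le_of_le h hB
  refine Runs.assign_seq (hsz (by simp [h0, hm]; omega)) ?_
  refine Runs.countdown (n := m) (fun k τ => τ mTop 0 = 2 ^ k ∧ τ mCode 0 = σ mCode 0 ∧
    ∀ i, k ≤ i → i < m → τ 1 i = if i ∈ S then 1 else 0) hmH (by simp [h0, hm]) ?_ ?_ ?_
  · exact ⟨by simp [htop], by simp, fun i h₁ h₂ => by omega⟩
  · rintro k τ hk ⟨ht, hc, ho⟩ _
    have hhalf : 2 ^ (k + 1) / 2 = 2 ^ k := by rw [pow_succ, Nat.mul_div_cancel _ (by norm_num)]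
    have h2 : 2 ^ k ≤ B := (Nat.pow_le_pow_right (by norm_num) hk.le).trans htopB
    refine Runs.assign_seq (hsz (by simpa [ht, hhalf] using h2)) ?_
    have e₁ : (⋆mCode / ⋆mTop - ⋆mCode / ⋆mTop / 2 * 2 : Expr).eval
        ((τ.write mIdx 0 k).write mTop 0
          ((⋆mTop / 2 : Expr).eval (τ.write mIdx 0 k))) = if k ∈ S then 1 else 0 := by
      rw [← digit_weight T hS hk, ← hcode, digit, Nat.mod_eq_sub_div_mul]
      simp [ht, hhalf, hc]
    have : 0 < 2 ^ m := by positivity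
    refine Runs.set (hsz ?_) ?_
    · rw [e₁]
      split_ifs <;> omega
    · rw [e₁]
      refine ⟨⟨by simp [ht, hhalf], by simp [hc], fun i h₁ h₂ => ?_⟩, by simp⟩
      rcases h₁.eq_or_lt with rfl | h₁
      · simp
      · have hne : i ≠ k := by omega
        simpa [hne] using ho i h₁ h₂
  · rintro τ ⟨_, _, ho⟩ _
    exact hQ τ fun i hi => ho i (Nat.zero_le _) hi

/-- The sets among which the program looks for the best one. -/
def Candidate (m K : ℕ) (S : Finset ℕ) : Prop := S ⊆ Finset.range m ∧ S.card = min K m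

open ExpMax in
/-- A candidate of maximal estimate that passes the test for the unit `u`, where `u` is minimal or
some candidate fails the test for half of it. -/
def Accepted (inp : ℕ → ℕ) (m K b e D u : ℕ) (S : Finset ℕ) : Prop :=
  Candidate m K S ∧ Passes m b e D u (cdf inp D e u) (tail inp D e (e * e) u) S ∧
    (∀ S', Candidate m K S' →
      estimate m b (e * e) D u (cdf inp D e u) (tail inp D e (e * e) u) S' ≤
        estimate m b (e * e) D u (cdf inp D e u) (tail inp D e (e * e) u) S) ∧
    (u = 1 ∨ ∃ v S', u = 2 * v ∧ 0 < v ∧ Candidate m K S' ∧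
      ¬ Passes m b e D v (cdf inp D e v) (tail inp D e (e * e) v) S')

open ExpMax in
theorem run_round (hst : Static inp m K b (e * e) D σ) (hf : Fits inp m K b (e * e) D R H B)
    (hu : FitsUnit inp m e b (e * e) D B u) (hu2 : 2 * u ≤ B) (hm : inp 0 = m)
    (hunit : σ mUnit 0 = u) (hz : ∀ z, (min K m + 1) * b ^ (e * e) ≤ z → σ mTab z = 0)
    (hQ : ∀ τ, Agree [mPtr, mBit, mArm, mEnt, mTail, mCdf, mIdx, mTmp, mTab, mBest, mCode, mUnit,
        mGo] τ σ →
      (∀ z, (min K m + 1) * b ^ (e * e) ≤ z → τ mTab z = 0) →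
      (∃ S, Candidate m K S ∧
        τ mCode 0 = 2 ^ m + ∑ a ∈ S, (tail inp D e (e * e) u a * 2 ^ m + 2 ^ a) ∧
        (∀ S', Candidate m K S' →
          estimate m b (e * e) D u (cdf inp D e u) (tail inp D e (e * e) u) S' ≤
            estimate m b (e * e) D u (cdf inp D e u) (tail inp D e (e * e) u) S) ∧
        ((¬ Passes m b e D u (cdf inp D e u) (tail inp D e (e * e) u) S ∧
            τ mGo 0 = σ mGo 0 ∧ τ mUnit 0 = u * 2) ∨
          (Passes m b e D u (cdf inp D e u) (tail inp D e (e * e) u) S ∧ τ mGo 0 = 0))) →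
      Q τ) :
    Runs R H (clearTable ;; fillTable e (e * e) ;; findBest (e * e) ;; nextUnit e) σ Q := by
  have hsz : ∀ {x}, x ≤ B → x.size ≤ R := fun h => size_le_of_le h hf.pow
  refine Runs.seq (run_clearTable hst hf.pow hf.iter hf.table hf.top hz fun σ₁ h₁ ht₁ => Runs.seq ?_)
  have hst₁ := hst.of_agree h₁ (by simp)
  have hu₁ : σ₁ mUnit 0 = u := by rw [h₁ mUnit (by simp), hunit]
  refine run_fillTable hst₁ hf hu hm hu₁ ht₁ fun σ₂ h₂ ht₂ hz₂ => Runs.seq ?_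
  have hst₂ := hst₁.of_agree h₂ (by simp)
  have hu₂ : σ₂ mUnit 0 = u := by rw [h₂ mUnit (by simp), hu₁]
  refine run_findBest (T := tail inp D e (e * e) u) hst₂ hf hu₂ hu.cdf hu.weight hu.value ht₂
    fun σ₃ h₃ ⟨S, hS, hc, hcode, hbest, hmax⟩ => ?_
  have hst₃ := hst₂.of_agree h₃ (by simp)
  have hu₃ : σ₃ mUnit 0 = u := by rw [h₃ mUnit (by simp), hu₂]
  have hgo : σ₃ mGo 0 = σ mGo 0 := by rw [h₃ mGo (by simp), h₂ mGo (by simp), h₁ mGo (by simp)]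
  have hz₃ : ∀ z, (min K m + 1) * b ^ (e * e) ≤ z → σ₃ mTab z = 0 := by
    rwa [h₃ mTab (by simp)]
  have hag : ∀ τ, Agree [mUnit, mGo] τ σ₃ → Agree [mPtr, mBit, mArm, mEnt, mTail, mCdf, mIdx, mTmp,
      mTab, mBest, mCode, mUnit, mGo] τ σ := fun τ h x hx => by
    simp at hx
    rw [h x (by simp [hx]), h₃ x (by simp [hx]), h₂ x (by simp [hx]), h₁ x (by simp [hx])]
  have hcond : (⋆mBest - (.const (3 * e) * ⋆mUnit * (⋆mBase - 1) * ⋆mDen + (⋆mBase - 1)) :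
      Expr).eval σ₃ = estimate m b (e * e) D u (cdf inp D e u) (tail inp D e (e * e) u) S -
        (3 * e * u * (b - 1) * D + (b - 1)) := by
    simp [hbest, hu₃, hst₃.base, hst₃.den]
  refine Runs.ite (fun hc' => ?_) (fun hc' => ?_)
  · rw [hcond, Nat.sub_ne_zero_iff_lt] at hc'
    refine Runs.assign (hsz (by simp [hu₃]; omega)) (hQ _ (hag _ fun x hx => ?_) ?_
      ⟨S, ⟨hS, hc⟩, ?_, fun S' h => hmax S' h.1 h.2, .inl ⟨not_le.2 hc', ?_, ?_⟩⟩)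
    · simp at hx
      simp [hx]
    · simpa using hz₃
    · simpa using hcode
    · simpa using hgo
    · simp [hu₃]
  · rw [hcond, Nat.sub_eq_zero_iff_le] at hc'
    refine Runs.assign (hsz (by simp)) (hQ _ (hag _ fun x hx => ?_) ?_
      ⟨S, ⟨hS, hc⟩, ?_, fun S' h => hmax S' h.1 h.2, .inr ⟨hc', ?_⟩⟩)
    · simp at hx
      simp [hx]
    · simpa using hz₃
    · simpa using hcode
    · simp

open ExpMax in
/-- The program finds an accepted set, provided that no unit of `2 ^ A` or more fails. -/
theorem run_algorithm {A : ℕ} (h0 : σ 0 = inp) (hz : σ mTab = fun _ => 0) (hm : inp 0 = m)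
    (hK : inp 1 = K) (hden : denom inp m = D) (hD0 : 0 < D)
    (hf : Fits inp m K b (e * e) D R H B)
    (hu : ∀ a ≤ A, FitsUnit inp m e b (e * e) D B (2 ^ a)) (hA : 2 ^ (A + 1) ≤ B)
    (hAH : A + 1 ≤ H)
    (hfail : ∀ a S, Candidate m K S →
      ¬ Passes m b e D (2 ^ a) (cdf inp D e (2 ^ a)) (tail inp D e (e * e) (2 ^ a)) S → a < A) :
    Runs R H (algorithm e) σ fun τ => ∃ u S, Accepted inp m K b e D u S ∧ 0 < u ∧
      ∀ i < m, τ 1 i = if i ∈ S then 1 else 0 := by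
  have hb : 0 < b := by have := hf.base; omega
  have hfull : 0 < b ^ (e * e) := by positivity
  have hfullB : b ^ (e * e) ≤ B :=
    (le_trans (Nat.le_mul_of_pos_left _ (by omega)) hf.table).trans hf.iter
  have hbB : b ≤ B := by
    have h₂ := hf.base
    have h₃ : 2 ^ 1 ≤ 2 ^ (A + 1) := Nat.pow_le_pow_right (by norm_num) (by omega)
    by_cases he : e * e = 0
    · rw [he] at h₂
      omega
    · exact (Nat.le_self_pow he b).trans hfullB
  refine Runs.seq (run_readDenom h0 hm hf.arms hf.entries hf.pow hf.iter hf.offset hf.top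
    (hden ▸ hf.den) (hden ▸ hD0) fun σ₁ h₁ hd₁ ht₁ => Runs.seq ?_)
  refine run_setup ((h₁ 0 (by simp)).trans h0) hm hK (hd₁.trans hden) ht₁ hf.pow hf.base hbB hfullB
    (hf.arms.trans hf.iter) (le_trans (Nat.one_le_two_pow) hf.top)
    fun σ₂ hst₂ h₂ hu₂ hgo₂ => Runs.seq ?_
  have hz₂ : σ₂ mTab = fun _ => 0 := by rw [h₂ mTab (by simp), h₁ mTab (by simp), hz]
  -- `k` counts the units up to `2 ^ A` that are left, the current one included.
  refine Runs.loop (fun k τ => Static inp m K b (e * e) D τ ∧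
    (∀ z, (min K m + 1) * b ^ (e * e) ≤ z → τ mTab z = 0) ∧
    ((τ mGo 0 = 1 ∧ ∃ a, a + k = A + 1 ∧ τ mUnit 0 = 2 ^ a ∧
        (a = 0 ∨ ∃ a' S', a = a' + 1 ∧ Candidate m K S' ∧ ¬ Passes m b e D (2 ^ a')
          (cdf inp D e (2 ^ a')) (tail inp D e (e * e) (2 ^ a')) S')) ∨
      (τ mGo 0 = 0 ∧ ∃ u S, Accepted inp m K b e D u S ∧ 0 < u ∧
        τ mCode 0 = 2 ^ m + ∑ a ∈ S, (tail inp D e (e * e) u a * 2 ^ m + 2 ^ a))))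
    hAH ⟨hst₂, by simp [hz₂], .inl ⟨hgo₂, 0, by omega, by simpa using hu₂, .inl rfl⟩⟩ ?_ ?_
  · rintro k τ ⟨hst, hz, hgo⟩ hc
    have hc : τ mGo 0 = 0 := hc
    obtain ⟨_, u, S, hacc, hu, hcode⟩ := hgo.resolve_left fun h => by
      have := h.1
      omega
    exact run_writeOutput hst.inp hm hst.top hacc.1.1 hcode hf.pow hf.arms hf.iter hf.top
      fun θ hθ => ⟨u, S, hacc, hu, hθ⟩
  · rintro k τ _ ⟨hst, hz, hgo⟩ hc
    have hc : τ mGo 0 ≠ 0 := hc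
    obtain ⟨hgo, a, hak, hua, ha⟩ := hgo.resolve_right fun h => hc h.1
    have haA : a ≤ A := by
      rcases ha with rfl | ⟨a', S', rfl, hS', hp⟩
      · omega
      · exact hfail a' S' hS' hp
    have h2a : 2 * 2 ^ a ≤ B := by
      rw [← pow_succ']
      exact (Nat.pow_le_pow_right (by norm_num) (by omega)).trans hA
    refine ⟨by omega, run_round hst hf (hu a haA) h2a hm hua hz fun θ hθ hθz hθS => ?_⟩
    obtain ⟨S, hS, hcode, hmax, hS'⟩ := hθS
    refine ⟨hst.of_agree hθ (by simp), hθz, ?_⟩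
    rcases hS' with ⟨hp, hg, hu'⟩ | ⟨hp, hg⟩
    · exact .inl ⟨hg.trans hgo, a + 1, by omega, by rw [hu', pow_succ], .inr ⟨a, S, rfl, hS, hp⟩⟩
    · refine .inr ⟨hg, 2 ^ a, S, ⟨hS, hp, hmax, ?_⟩, by positivity, hcode⟩
      rcases ha with rfl | ⟨a', S', rfl, h₁, h₂⟩
      · exact .inl rfl
      · exact .inr ⟨2 ^ a', S', by rw [pow_succ'], by positivity, h₁, h₂⟩

end correctness

end KMaxProgram

/-! ### The input format -/

namespace List

theorem getD_flatMap_length_add {α β : Type*} (l : List α) (f : α → List β) (d : β) {a r : ℕ}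
    (ha : a < l.length) (hr : r < (f l[a]).length) :
    (l.flatMap f).getD (((l.take a).flatMap f).length + r) d = (f l[a]).getD r d := by
  have h : l.flatMap f = (l.take a).flatMap f ++ (f l[a] ++ (l.drop (a + 1)).flatMap f) := by
    conv_lhs => rw [← List.take_append_drop a l, List.drop_eq_getElem_cons ha]
    rw [List.flatMap_append, List.flatMap_cons]
  rw [h, List.getD_append_right _ _ _ _ (by omega), Nat.add_sub_cancel_left, List.getD_append _ _ _ _ hr]

end List

namespace RAM

theorem bitLength_append (l l' : List ℕ) : bitLength (l ++ l') = bitLength l + bitLength l' := by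
  simp [bitLength]

theorem bitLength_cons (x : ℕ) (l : List ℕ) : bitLength (x :: l) = x.size + 1 + bitLength l := by
  simp [bitLength]

theorem bitLength_flatMap_finRange {n : ℕ} (f : Fin n → List ℕ) :
    bitLength ((List.finRange n).flatMap f) = ∑ i, bitLength (f i) := by
  rw [Fin.sum_univ_def]
  induction List.finRange n with
  | nil => simp [bitLength]
  | cons x l ih => rw [List.flatMap_cons, bitLength_append, ih, List.map_cons, List.sum_cons]

theorem length_le_bitLength (l : List ℕ) : l.length ≤ bitLength l := by
  induction l with
  | nil => simp
  | cons x l ih =>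
    rw [bitLength_cons, List.length_cons]
    omega

theorem size_getD_le_bitLength (l : List ℕ) (i : ℕ) : (l.getD i 0).size ≤ bitLength l := by
  induction l generalizing i with
  | nil => simp
  | cons x l ih =>
    rw [bitLength_cons]
    cases i with
    | zero =>
      rw [List.getD_cons_zero]
      omega
    | succ i =>
      have := ih i
      rw [List.getD_cons_succ]
      omega

end RAM

namespace KMaxInstance

open RAM KMaxProgram

variable (I : KMaxInstance)

/-- The input as a function on positions. -/
def input (i : ℕ) : ℕ := I.encode.getD i 0

/-- The part of the input that describes an arm. -/
def block (i : Fin I.m) : List ℕ :=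
  I.s i :: (List.finRange (I.s i)).flatMap fun j =>
    [(I.v i j).num, (I.v i j).den, (I.p i j).num, (I.p i j).den]

theorem encode_eq : I.encode = [I.m, I.K] ++ (List.finRange I.m).flatMap I.block := rfl

theorem length_block (i : Fin I.m) : (I.block i).length = 1 + 4 * I.s i := by
  simp [block, List.length_flatMap]
  ring

theorem offset_input {a : ℕ} (ha : a ≤ I.m) :
    offset I.input a = 2 + (((List.finRange I.m).take a).flatMap I.block).length ∧
    ∀ (h : a < I.m) (r : ℕ), r < 1 + 4 * I.s ⟨a, h⟩ →
      I.input (offset I.input a + r) = (I.block ⟨a, h⟩).getD r 0 := by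
  have key : ∀ a ≤ I.m, offset I.input a =
      2 + (((List.finRange I.m).take a).flatMap I.block).length →
      ∀ (h : a < I.m) (r : ℕ), r < 1 + 4 * I.s ⟨a, h⟩ →
      I.input (offset I.input a + r) = (I.block ⟨a, h⟩).getD r 0 := by
    intro a _ hoff h r hr
    rw [input, encode_eq, hoff, List.getD_append_right _ _ _ _ (by simp; omega)]
    have e : 2 + (((List.finRange I.m).take a).flatMap I.block).length + r - [I.m, I.K].length =
        (((List.finRange I.m).take a).flatMap I.block).length + r := by
      simp only [List.length_cons, List.length_nil]
      omega
    rw [e, List.getD_flatMap_length_add _ _ _ (by simpa using h)]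
    · simp
    · simpa [length_block] using hr
  suffices H : offset I.input a = 2 + (((List.finRange I.m).take a).flatMap I.block).length from
    ⟨H, key a ha H⟩
  induction a with
  | zero => simp [offset]
  | succ a ih =>
    have ih := ih (by omega)
    have h0 := key a (by omega) ih ha 0 (by omega)
    rw [add_zero, block, List.getD_cons_zero] at h0
    have ht : (List.finRange I.m).take (a + 1) = (List.finRange I.m).take a ++ [⟨a, ha⟩] := by
      rw [List.take_add_one, List.getElem?_eq_getElem (by simpa using ha)]
      simp
    rw [offset, h0, ih, ht, List.flatMap_append, List.length_append]
    simp [length_block]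
    ring

theorem input_offset (i : Fin I.m) : I.input (offset I.input i) = I.s i := by
  have := (I.offset_input i.2.le).2 i.2 0 (by omega)
  simpa [block] using this

theorem input_entry (i : Fin I.m) (j : Fin (I.s i)) {c : ℕ} (hc : c < 4) :
    I.input (entry I.input i j + c) =
      [(I.v i j).num, (I.v i j).den, (I.p i j).num, (I.p i j).den].getD c 0 := by
  have hj := j.2
  have h := (I.offset_input i.2.le).2 i.2 (4 * j + c + 1) (by
    show _ < 1 + 4 * I.s i
    omega)
  have hl : (((List.finRange (I.s i)).take j).flatMap fun j =>
      [(I.v i j).num, (I.v i j).den, (I.p i j).num, (I.p i j).den]).length = 4 * j := by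
    simp [List.length_flatMap, mul_comm]
  have h' := List.getD_flatMap_length_add (List.finRange (I.s i))
    (fun j => [(I.v i j).num, (I.v i j).den, (I.p i j).num, (I.p i j).den]) 0 (a := j) (r := c)
    (by simp) (by simpa using hc)
  rw [hl] at h'
  rw [entry, show offset I.input i + 1 + 4 * j + c = offset I.input i + (4 * j + c + 1) by ring, h,
    block, List.getD_cons_succ]
  refine h'.trans ?_
  simp

theorem denom_input : KMaxProgram.denom I.input I.m = I.denom := by
  rw [KMaxProgram.denom, Finset.prod_range, denom]
  refine Finset.prod_congr rfl fun i _ => ?_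
  rw [armDenom, input_offset, Finset.prod_range]
  refine Finset.prod_congr rfl fun j _ => ?_
  rw [input_entry I i j (by norm_num), input_entry I i j (by norm_num)]
  simp

theorem mass_input (i : Fin I.m) (j : Fin (I.s i)) :
    KMaxProgram.mass I.input I.denom (entry I.input i j) = I.mass i j := by
  rw [KMaxProgram.mass, input_entry I i j (by norm_num), input_entry I i j (by norm_num)]
  simp [mass]

theorem scaled_input (e : ℕ) (i : Fin I.m) (j : Fin (I.s i)) :
    KMaxProgram.scaled I.input I.denom e (entry I.input i j) = I.scaled e i j := by
  have := input_entry I i j (c := 0) (by norm_num)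
  rw [add_zero] at this
  rw [KMaxProgram.scaled, this, input_entry I i j (by norm_num)]
  simp [scaled]

theorem cdf_input (e u : ℕ) (i : Fin I.m) (j : ℕ) :
    KMaxProgram.cdf I.input I.denom e u i j = I.cdf e u i j := by
  rw [KMaxProgram.cdf, partialCdf, input_offset, Finset.sum_range, cdf]
  exact Finset.sum_congr rfl fun l _ => by rw [mass_input, scaled_input]

theorem tail_input (e L u : ℕ) (i : Fin I.m) :
    KMaxProgram.tail I.input I.denom e L u i = I.tail e L u i := by
  rw [KMaxProgram.tail, partialTail, input_offset, Finset.sum_range, tail]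
  exact Finset.sum_congr rfl fun l _ => by rw [mass_input, scaled_input]

/-! ### Sizes -/

theorem bitLength_encode : bitLength I.encode = I.m.size + 1 + (I.K.size + 1) +
    ∑ i, ((I.s i).size + 1 + ∑ j, ((I.v i j).num.size + 1 + ((I.v i j).den.size + 1) +
      ((I.p i j).num.size + 1) + ((I.p i j).den.size + 1))) := by
  rw [encode_eq, bitLength_append, bitLength_flatMap_finRange]
  simp only [block, bitLength_cons, bitLength_flatMap_finRange]
  simp only [bitLength, List.map_nil, List.sum_nil, add_zero, ← add_assoc]

/-- The denominators have together at most as many bits as the input. -/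
theorem denom_le : I.denom ≤ 2 ^ bitLength I.encode := by
  have h : I.denom ≤ 2 ^ ∑ i, ∑ j, ((I.v i j).den.size + (I.p i j).den.size) := by
    rw [← Finset.prod_pow_eq_pow_sum, denom]
    refine Finset.prod_le_prod' fun i _ => ?_
    rw [← Finset.prod_pow_eq_pow_sum]
    refine Finset.prod_le_prod' fun j _ => ?_
    rw [pow_add]
    exact Nat.mul_le_mul (Nat.lt_size_self _).le (Nat.lt_size_self _).le
  refine h.trans (Nat.pow_le_pow_right (by norm_num) ?_)
  rw [bitLength_encode]
  refine le_trans (Finset.sum_le_sum fun i _ => ?_) (Nat.le_add_left _ _)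
  refine le_trans (Finset.sum_le_sum fun j _ => ?_) (Nat.le_add_left _ _)
  omega

theorem num_v_le (i : Fin I.m) (j : Fin (I.s i)) : (I.v i j).num ≤ 2 ^ bitLength I.encode := by
  have h := size_getD_le_bitLength I.encode (entry I.input i j)
  have h' := input_entry I i j (c := 0) (by norm_num)
  rw [add_zero, input] at h'
  rw [h'] at h
  exact (Nat.lt_size_self _).le.trans (Nat.pow_le_pow_right (by norm_num) h)

theorem v_le (i : Fin I.m) (j : Fin (I.s i)) :
    (I.v i j : ℝ≥0) ≤ (2 : ℝ≥0) ^ bitLength I.encode := by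
  have h₁ : (I.v i j : ℝ≥0) ≤ (I.v i j).num := by
    rw [NNRat.cast_def]
    refine div_le_self (by positivity) ?_
    exact_mod_cast NNRat.den_pos _
  exact h₁.trans (by exact_mod_cast I.num_v_le i j)

theorem offset_le : offset I.input I.m ≤ bitLength I.encode := by
  refine le_trans ?_ (length_le_bitLength _)
  rw [(I.offset_input le_rfl).1, encode_eq, List.take_of_length_le (by simp), List.length_append]
  simp

theorem m_le : I.m ≤ bitLength I.encode := by
  refine le_trans ?_ I.offset_le
  have : ∀ a, a ≤ offset I.input a := fun a => by
    induction a with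
    | zero => omega
    | succ a ih =>
      rw [offset]
      omega
  exact this _

theorem s_le {a : ℕ} (ha : a < I.m) : I.input (offset I.input a) ≤ bitLength I.encode := by
  have := offset_mono I.input (Nat.succ_le_of_lt ha)
  rw [Nat.succ_eq_add_one, offset] at this
  have := I.offset_le
  omega

theorem tail_le (e L u : ℕ) (i : Fin I.m) :
    I.tail e L u i ≤ e * 2 ^ (4 * bitLength I.encode) := by
  have h : ∀ j, I.scaled e i j ≤ 2 ^ (3 * bitLength I.encode) * e := fun j => by
    rw [show 3 * bitLength I.encode = bitLength I.encode + bitLength I.encode +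
      bitLength I.encode by ring, pow_add, pow_add]
    exact Nat.mul_le_mul_right _ (Nat.mul_le_mul (Nat.mul_le_mul (I.num_v_le i j)
      ((Nat.div_le_self _ _).trans I.denom_le)) I.denom_le)
  calc I.tail e L u i ≤ ∑ j, I.mass i j * (2 ^ (3 * bitLength I.encode) * e) :=
        Finset.sum_le_sum fun j _ => Nat.mul_le_mul_left _ ((Nat.sub_le _ _).trans (h j))
    _ = I.denom * (2 ^ (3 * bitLength I.encode) * e) := by rw [← Finset.sum_mul, sum_mass]
    _ ≤ 2 ^ bitLength I.encode * (2 ^ (3 * bitLength I.encode) * e) :=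
        Nat.mul_le_mul_right _ I.denom_le
    _ = e * 2 ^ (4 * bitLength I.encode) := by ring

theorem sum_tail_le (e L u : ℕ) {S : Finset ℕ} (hS : S ⊆ Finset.range I.m) :
    ∑ a ∈ S, KMaxProgram.tail I.input I.denom e L u a ≤ e * 2 ^ (5 * bitLength I.encode) := by
  calc ∑ a ∈ S, KMaxProgram.tail I.input I.denom e L u a
      ≤ ∑ a ∈ Finset.range I.m, e * 2 ^ (4 * bitLength I.encode) := by
        refine (Finset.sum_le_sum_of_subset hS).trans (Finset.sum_le_sum fun a ha => ?_)
        rw [I.tail_input e L u ⟨a, Finset.mem_range.1 ha⟩]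
        exact I.tail_le _ _ _ _
    _ = I.m * (e * 2 ^ (4 * bitLength I.encode)) := by simp
    _ ≤ 2 ^ bitLength I.encode * (e * 2 ^ (4 * bitLength I.encode)) :=
        Nat.mul_le_mul_right _ (I.m_le.trans Nat.lt_two_pow_self.le)
    _ = e * 2 ^ (5 * bitLength I.encode) := by ring

/-- Bounds the number of iterations of every loop on inputs of bit length `n`. -/
def iterBound (L n : ℕ) : ℕ := (n + 1) * (L * n + 2) ^ L + 3 * n + 1

/-- The constant in the bound on the numbers that occur. -/
def factor (e : ℕ) : ℕ := (e * e + 1) * (e * e + e + 2)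

/-- Bounds the numbers that occur on inputs of bit length `n`. -/
def cellBound (e n : ℕ) : ℕ := iterBound (e * e) n + factor e * 2 ^ (6 * n)

/-- Bounds the bit length of the numbers that occur on inputs of bit length `n`. -/
def sizeBound (e n : ℕ) : ℕ := iterBound (e * e) n + factor e + 6 * n + 1

theorem cellBound_lt (e n : ℕ) : cellBound e n < 2 ^ sizeBound e n := by
  have h₁ : iterBound (e * e) n < 2 ^ (iterBound (e * e) n + factor e + 6 * n) :=
    Nat.lt_two_pow_self.trans_le (Nat.pow_le_pow_right (by norm_num) (by omega))
  have h₂ : factor e * 2 ^ (6 * n) ≤ 2 ^ (iterBound (e * e) n + factor e + 6 * n) := by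
    rw [pow_add]
    exact Nat.mul_le_mul_right _
      (Nat.lt_two_pow_self.le.trans (Nat.pow_le_pow_right (by norm_num) (by omega)))
  rw [cellBound, sizeBound, pow_succ]
  omega

theorem le_cellBound {e n x k : ℕ} (h : x ≤ k * 2 ^ (6 * n)) (hk : k ≤ factor e) :
    x ≤ cellBound e n :=
  (h.trans (Nat.mul_le_mul_right _ hk)).trans (Nat.le_add_left _ _)

theorem fits (e : ℕ) : Fits I.input I.m I.K (e * e * I.m + 2) (e * e) I.denom
    (sizeBound e (bitLength I.encode)) (iterBound (e * e) (bitLength I.encode))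
    (cellBound e (bitLength I.encode)) := by
  have hm := I.m_le
  have h1 : 1 ≤ factor e := Nat.mul_pos (by positivity) (by positivity)
  have hpow : 2 ^ bitLength I.encode ≤ 1 * 2 ^ (6 * bitLength I.encode) := by
    rw [one_mul]
    exact Nat.pow_le_pow_right (by norm_num) (by omega)
  have hiter : bitLength I.encode ≤ iterBound (e * e) (bitLength I.encode) := by
    unfold iterBound
    omega
  have hle : iterBound (e * e) (bitLength I.encode) ≤ cellBound e (bitLength I.encode) :=
    Nat.le_add_right _ _
  refine ⟨cellBound_lt _ _, hle, rfl, ?_, hm.trans hiter,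
    fun a ha => (I.s_le ha).trans hiter, (I.offset_le.trans hiter).trans hle, ?_, ?_⟩
  · have : (min I.K I.m + 1) * (e * e * I.m + 2) ^ (e * e) ≤
        (bitLength I.encode + 1) * (e * e * bitLength I.encode + 2) ^ (e * e) :=
      Nat.mul_le_mul (by omega) (Nat.pow_le_pow_left
        (Nat.add_le_add_right (Nat.mul_le_mul_left _ hm) _) _)
    unfold iterBound
    omega
  · exact le_cellBound ((Nat.pow_le_pow_right (by norm_num) hm).trans hpow) h1
  · exact le_cellBound (I.denom_le.trans hpow) h1

theorem fitsUnit (e : ℕ) {a : ℕ} (ha : a ≤ 3 * bitLength I.encode) :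
    FitsUnit I.input I.m e (e * e * I.m + 2) (e * e) I.denom
      (cellBound e (bitLength I.encode)) (2 ^ a) := by
  set n := bitLength I.encode with hn
  have hm : I.m ≤ n := I.m_le
  have hua : 2 ^ a ≤ 2 ^ (3 * n) := Nat.pow_le_pow_right (by norm_num) ha
  have huD : 2 ^ a * I.denom ≤ 2 ^ (5 * n) := by
    refine (Nat.mul_le_mul hua I.denom_le).trans ?_
    rw [← pow_add]
    exact Nat.pow_le_pow_right (by norm_num) (by omega)
  have hN : e * e * I.m + 1 ≤ (e * e + 1) * 2 ^ n := by
    have h₁ : e * e * I.m ≤ e * e * 2 ^ n :=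
      Nat.mul_le_mul_left _ (hm.trans Nat.lt_two_pow_self.le)
    have h₂ : 1 ≤ 2 ^ n := Nat.one_le_two_pow
    linarith
  have h6 : 2 ^ n * 2 ^ (5 * n) = 2 ^ (6 * n) := by ring
  have hsub : e * e * I.m + 2 - 1 = e * e * I.m + 1 := by omega
  refine ⟨fun i hi j _ => ?_, fun S hS => ?_, fun z S hS => ?_⟩
  · exact (I.cdf_input e _ ⟨i, hi⟩ j).trans_le (I.cdf_le _ _ _ _)
  · refine le_cellBound (k := e + 2) ?_ (by unfold factor; nlinarith)
    unfold KMaxProgram.weight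
    rw [weight_eq _ hS]
    have h₁ : ∑ j ∈ Finset.range I.m, (if j ∈ S then 1 else 0) * 2 ^ j < 2 ^ I.m :=
      KnapsackTable.sum_digits_lt (c := fun j => if j ∈ S then 1 else 0) I.m
        fun j _ => by split_ifs <;> norm_num
    have h₂ := I.sum_tail_le e (e * e) (2 ^ a) hS
    rw [← hn] at h₂
    have h₃ : 2 ^ I.m ≤ 2 ^ n := Nat.pow_le_pow_right (by norm_num) hm
    have h₄ : 1 ≤ 2 ^ (5 * n) := Nat.one_le_two_pow
    have h₅ : (2 + ∑ a_1 ∈ S, KMaxProgram.tail I.input I.denom e (e * e) (2 ^ a) a_1) * 2 ^ I.m ≤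
        ((e + 2) * 2 ^ (5 * n)) * 2 ^ n := Nat.mul_le_mul (by linarith) h₃
    rw [mul_assoc, mul_comm (2 ^ (5 * n)), h6] at h₅
    linarith
  · refine le_cellBound (k := (e * e + 1) * (e * e + e + 1)) ?_
      (Nat.mul_le_mul_left _ (by omega))
    unfold KnapsackTable.value
    rw [hsub]
    have h₁ : ∑ j ∈ Finset.range (e * e), (e * e * I.m + 1 -
        KnapsackTable.digit (e * e * I.m + 2) j z) * (2 ^ a * I.denom) ≤
        e * e * ((e * e + 1) * 2 ^ n * 2 ^ (5 * n)) := by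
      refine (Finset.sum_le_card_nsmul _ _ _ fun j _ =>
        Nat.mul_le_mul ((Nat.sub_le _ _).trans hN) huD).trans_eq ?_
      simp
    have h₂ := I.sum_tail_le e (e * e) (2 ^ a) hS
    rw [← hn] at h₂
    have h₄ : 1 ≤ 2 ^ (5 * n) := Nat.one_le_two_pow
    have h₃ : (e * e * I.m + 1) * (1 + ∑ a_1 ∈ S, KMaxProgram.tail I.input I.denom e (e * e)
        (2 ^ a) a_1) ≤ (e * e + 1) * 2 ^ n * ((e + 1) * 2 ^ (5 * n)) :=
      Nat.mul_le_mul hN (by linarith)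
    refine (Nat.add_le_add h₁ h₃).trans_eq ?_
    rw [← h6]
    ring

theorem ae_law_le (i : Fin I.m) :
    ∀ᵐ y ∂I.law i, y ≤ (2 : ℝ≥0) ^ bitLength I.encode :=
  I.ae_law i fun j => I.v_le i j

theorem describes_input {e : ℕ} (he : 0 < e) (L u : ℕ) :
    ExpMax.Describes I.law L I.denom u (I.denom ^ 2 * e) (KMaxProgram.cdf I.input I.denom e u)
      (KMaxProgram.tail I.input I.denom e L u) :=
  I.describes he (fun i j _ => I.cdf_input e u i j) fun i => I.tail_input e L u i

theorem exists_map_eq {m K : ℕ} {S : Finset ℕ} (h : Candidate m K S) :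
    ∃ S' : Finset (Fin m), S'.map Fin.valEmbedding = S ∧ S'.card = min K m := by
  refine ⟨Finset.univ.filter fun i : Fin m => (i : ℕ) ∈ S, ?_⟩
  have : (Finset.univ.filter fun i : Fin m => (i : ℕ) ∈ S).map Fin.valEmbedding = S := by
    ext a
    simp only [Finset.mem_map, Finset.mem_filter, Finset.mem_univ, true_and, Fin.valEmbedding_apply]
    constructor
    · rintro ⟨i, hi, rfl⟩
      exact hi
    · exact fun ha => ⟨⟨a, Finset.mem_range.1 (h.1 ha)⟩, ha, rfl⟩
  refine ⟨this, ?_⟩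
  rw [← h.2, ← Finset.card_map Fin.valEmbedding, this]

theorem candidate_map {m K : ℕ} {S : Finset (Fin m)} (h : S.card = min K m) :
    Candidate m K (S.map Fin.valEmbedding) := by
  refine ⟨fun a ha => ?_, by simpa using h⟩
  obtain ⟨i, _, rfl⟩ := Finset.mem_map.1 ha
  simp

/-- Units of `8 ^ n` or more pass the test, since no value exceeds `2 ^ n`. -/
theorem lt_of_fails {e : ℕ} (he : 12 ≤ e) {a : ℕ} {S : Finset ℕ} (hS : Candidate I.m I.K S)
    (hp : ¬ ExpMax.Passes I.m (e * e * I.m + 2) e I.denom (2 ^ a)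
      (KMaxProgram.cdf I.input I.denom e (2 ^ a))
      (KMaxProgram.tail I.input I.denom e (e * e) (2 ^ a)) S) :
    a < 3 * bitLength I.encode := by
  obtain ⟨S, rfl, -⟩ := exists_map_eq hS
  have hD := I.denom_pos
  have hD' : (0 : ℝ) < I.denom := by exact_mod_cast hD
  have he' : (0 : ℝ) < e := by exact_mod_cast (by omega : 0 < e)
  have h₁ := ExpMax.lt_of_not_passes (μ := I.law) I.ae_law_le (c := I.denom ^ 2 * e) (by positivity)
    hD he (by positivity) (by omega) (I.describes_input (by omega) _ _) S hp
  have h₂ := h₁.trans_le (ExpMax.integral_sup_le_bound I.ae_law_le S)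
  rw [div_lt_iff₀ (by positivity)] at h₂
  push_cast at h₂
  have h₃ : (2 : ℝ) ^ a < 2 ^ bitLength I.encode * I.denom ^ 2 :=
    lt_of_mul_lt_mul_left (by linarith) he'.le
  have h₄ : 2 ^ a < 2 ^ bitLength I.encode * I.denom ^ 2 := by exact_mod_cast h₃
  have h₅ : 2 ^ bitLength I.encode * I.denom ^ 2 ≤ 2 ^ (3 * bitLength I.encode) := by
    refine (Nat.mul_le_mul_left _ (Nat.pow_le_pow_left I.denom_le 2)).trans_eq ?_
    ring
  exact (Nat.pow_lt_pow_iff_right (by norm_num)).1 (h₄.trans_le h₅)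

theorem approx_of_accepted {e : ℕ} (he : 12 ≤ e) {u : ℕ} (hu : 0 < u) {S : Finset (Fin I.m)}
    (hS : Accepted I.input I.m I.K (e * e * I.m + 2) e I.denom u (S.map Fin.valEmbedding))
    (T : Finset (Fin I.m)) (hT : T.card ≤ I.K) :
    (1 - 12 / e) * I.reward T ≤ I.reward S := by
  obtain ⟨hc, hp, hmax, hmin⟩ := hS
  have hD := I.denom_pos
  have hD' : (0 : ℝ) < I.denom := by exact_mod_cast hD
  have he' : (0 : ℝ) < e := by exact_mod_cast (by omega : 0 < e)
  refine ExpMax.approx_of_passes (μ := I.law) I.ae_law_le (c := I.denom ^ 2 * e) (by positivity)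
    hD he hu (by omega) (I.describes_input (by omega) _ _) S hp (by simpa using hc.2)
    (fun S' hS' => hmax _ (candidate_map hS')) ?_ T hT
  rcases hmin with rfl | ⟨v, S', rfl, hv, hS', hf⟩
  · exact .inl ⟨rfl, fun i => I.excess_zero_or (by omega) i⟩
  · obtain ⟨S', rfl, hc'⟩ := exists_map_eq hS'
    refine .inr ⟨S', hc', ?_⟩
    have h₁ := ExpMax.lt_of_not_passes (μ := I.law) I.ae_law_le (c := I.denom ^ 2 * e)
      (by positivity) hD he hv (by omega) (I.describes_input (by omega) _ _) S' hf
    refine lt_of_eq_of_lt ?_ h₁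
    push_cast
    field_simp

end KMaxInstance

open RAM KMaxProgram KMaxInstance in
theorem theorem4 (ε : ℝ) (hε : 0 < ε) :
    ∃ (alg : RAM.Cmd) (q : Polynomial ℕ), ∀ I : KMaxInstance,
      ∃ (t : ℕ) (σ : RAM.State) (S : Finset (Fin I.m)),
        RAM.Exec alg (RAM.initState I.encode) t σ ∧
        t ≤ q.eval (RAM.bitLength I.encode) ∧
        (∀ i : Fin I.m, σ 1 i = if i ∈ S then 1 else 0) ∧
        S.card ≤ I.K ∧ (I.K ≤ I.m → S.card = I.K) ∧
        ∀ T : Finset (Fin I.m), T.card ≤ I.K → (1 - ε) * I.reward T ≤ I.reward S := by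
  obtain ⟨e, hεe⟩ := exists_nat_ge (max 12 (12 / ε))
  have he : 12 ≤ e := by exact_mod_cast (le_max_left _ _).trans hεe
  have he' : (0 : ℝ) < e := by exact_mod_cast (by omega : 0 < e)
  have hεe : 12 / (e : ℝ) ≤ ε := by
    rw [div_le_iff₀ he', mul_comm, ← div_le_iff₀ hε]
    exact (le_max_right _ _).trans hεe
  let iter : Polynomial ℕ := (Polynomial.X + 1) * (Polynomial.C (e * e) * Polynomial.X + 2) ^ (e * e)
    + 3 * Polynomial.X + 1
  have hiter : ∀ n, iter.eval n = iterBound (e * e) n := fun n => by simp [iter, iterBound]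
  refine ⟨algorithm e, (algorithm e).time.comp iter *
    (iter + Polynomial.C (factor e) + 6 * Polynomial.X + 1 + 1), fun I => ?_⟩
  have h0 : initState I.encode 0 = I.input := by
    funext i
    simp [initState, input]
  have hbdd : Bdd (sizeBound e (bitLength I.encode)) (initState I.encode) := fun a i => by
    unfold initState
    split_ifs
    · refine (size_getD_le_bitLength _ _).trans ?_
      unfold sizeBound
      omega
    · simp
  have h2 : 2 ≤ factor e := by unfold factor; nlinarith
  obtain ⟨t, σ, hex, ht, -, u, S, hS, hu, hout⟩ := run_algorithm (A := 3 * bitLength I.encode)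
    (e := e) h0 (funext fun _ => rfl) (by simp [input, encode]) (by simp [input, encode])
    I.denom_input I.denom_pos (I.fits e) (fun a ha => I.fitsUnit e ha)
    (le_cellBound (k := 2) (by
      rw [pow_succ']
      exact Nat.mul_le_mul_left _ (Nat.pow_le_pow_right (by norm_num) (by omega))) h2)
    (by unfold iterBound; omega) (fun a S hS hp => I.lt_of_fails he hS hp) hbdd
  obtain ⟨S, rfl, hcard⟩ := exists_map_eq hS.1
  refine ⟨t, σ, S, hex, ht.trans_eq ?_, fun i => ?_, by omega, fun h => by omega, fun T hT => ?_⟩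
  · simp [hiter, sizeBound]
  · rw [hout i i.2]
    simp [Fin.val_inj]
  · refine le_trans (mul_le_mul_of_nonneg_right (by linarith) ?_) (I.approx_of_accepted he hu hS T hT)
    exact MeasureTheory.integral_nonneg fun _ => NNReal.coe_nonneg _
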